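/- Let $\alpha>0$, $\alpha\neq 1$, and let $$U^{\alpha}=\{(z_1,z_2)\in\mathbb C^2:\ |z_1|^{2/\alpha}+|z_2|^2<1\}.$$ Let $K(z;\bar w)$ be the Bergman kernel of $U^\alpha$, i.e. the reproducing kernel of the space $A^2(U^\alpha)$ of holomorphic functions on $U^\alpha$ that are square integrable with respect to Lebesgue measure, and let $$d(z,w)=\left(1-\frac{|K(z;\bar w)|}{K(z;\bar z)^{1/2}K(w;\bar w)^{1/2}}\right)^{1/2},\qquad z,w\in U^\alpha,$$ be the Skwarczyński distance. Then $d$ is a metric on $U^\alpha$, and the metric space $(U^\alpha,d)$ has the following property. There is $r_0<1$ (depending on $\alpha$) such that for every $r\in(r_0,1)$ there exist an integer $N(r)$, a constant $C(r)<1$ and a countable covering $\{F_j\}$ of $U^\alpha$ by pairwise disjoint Borel sets of $(U^\alpha,d)$ satisfying: 1. every point of $U^\alpha$ belongs to at most $N(r)$ of the sets $G_j=\{z\in U^\alpha: d(z,F_j)\le r\}$, where $d(z,F_j)=\inf_{w\in F_j}d(z,w)$ (and $\inf\emptyset=\infty$); 2. $\sup_j \operatorname{diam}_d F_j<C(r)$.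 -/

import Mathlib

open MeasureTheory

/-- The Thullen domain `U^α = {(z₁, z₂) ∈ ℂ² : |z₁|^(2/α) + |z₂|² < 1}`. -/
def thullenDomain (α : ℝ) : Set (ℂ × ℂ) :=
  {z | ‖z.1‖ ^ (2 / α) + ‖z.2‖ ^ 2 < 1}

/-- Membership in the Bergman space `A²(Ω)`: holomorphic on the open set `Ω ⊆ ℂ²` and square
integrable on `Ω` with respect to Lebesgue measure. -/
def MemBergmanSpace (Ω : Set (ℂ × ℂ)) (f : ℂ × ℂ → ℂ) : Prop :=
  DifferentiableOn ℂ f Ω ∧ MemLp f 2 (volume.restrict Ω)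

/-- `K` is a Bergman kernel of `Ω`, where `K z w` stands for `K_Ω(z; w̄)`: for every `w ∈ Ω` the
function `K_w = K(·; w̄)` lies in `A²(Ω)`, and `f(w) = ⟨f, K_w⟩` for every `f ∈ A²(Ω)`. -/
def IsBergmanKernel (Ω : Set (ℂ × ℂ)) (K : ℂ × ℂ → ℂ × ℂ → ℂ) : Prop :=
  ∀ w ∈ Ω, MemBergmanSpace Ω (fun z => K z w) ∧
    ∀ f : ℂ × ℂ → ℂ, MemBergmanSpace Ω f →
      f w = ∫ z in Ω, f z * (starRingEnd ℂ) (K z w)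

/-- Two Bergman kernels of `Ω` agree on `Ω × Ω`. -/
theorem IsBergmanKernel.unique {Ω : Set (ℂ × ℂ)} {K L : ℂ × ℂ → ℂ × ℂ → ℂ}
    (hK : IsBergmanKernel Ω K) (hL : IsBergmanKernel Ω L) {z w : ℂ × ℂ}
    (hz : z ∈ Ω) (hw : w ∈ Ω) : K z w = L z w := by
  have key : ∀ {A B : ℂ × ℂ → ℂ × ℂ → ℂ}, IsBergmanKernel Ω A → IsBergmanKernel Ω B →
      ∀ {x y : ℂ × ℂ}, x ∈ Ω → y ∈ Ω → A x y = (starRingEnd ℂ) (B y x) := by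
    intro A B hA hB x y hx hy
    have h1 := (hB x hx).2 _ (hA y hy).1
    have h2 := (hA y hy).2 _ (hB x hx).1
    rw [h1, h2, ← integral_conj]
    congr 1
    funext t
    simp [mul_comm]
  rw [key hK hK hz hw, key hL hK hz hw]

open Classical in
/-- The Bergman kernel `K_Ω(z; w̄)`, the function on `Ω × Ω` with the reproducing property (set to
`0` if there is none). -/
noncomputable def bergmanKernel (Ω : Set (ℂ × ℂ)) : ℂ × ℂ → ℂ × ℂ → ℂ :=
  if h : ∃ K, IsBergmanKernel Ω K then h.choose else 0

/-- The chosen kernel agrees on `Ω × Ω` with every function that has the reproducing property. -/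
theorem bergmanKernel_eq {Ω : Set (ℂ × ℂ)} {K : ℂ × ℂ → ℂ × ℂ → ℂ}
    (hK : IsBergmanKernel Ω K) {z w : ℂ × ℂ} (hz : z ∈ Ω) (hw : w ∈ Ω) :
    bergmanKernel Ω z w = K z w := by
  have h : ∃ K, IsBergmanKernel Ω K := ⟨K, hK⟩
  rw [bergmanKernel, dif_pos h]
  exact h.choose_spec.unique hK hz hw

/-- The Skwarczyński distance
`d(z, w) = (1 - |K(z; w̄)| / (K(z; z̄)^(1/2) K(w; w̄)^(1/2)))^(1/2)`;
the values `K(z; z̄)` are real and nonnegative. -/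
noncomputable def skwarczynskiDist (Ω : Set (ℂ × ℂ)) (z w : ℂ × ℂ) : ℝ :=
  √(1 - ‖bergmanKernel Ω z w‖ /
    (√(bergmanKernel Ω z z).re * √(bergmanKernel Ω w w).re))

/-- The covering property of a metric space `X` at scale `r`: for some integer `N` and some
constant `C < 1` there is a countable family of pairwise disjoint Borel sets `F j` that covers `X`,
such that every point lies in at most `N` of the sets `G j = {z | d(z, F j) ≤ r}`, and
`sup_j diam (F j) < C`. Point-set distances and diameters take values in `[0, ∞]`, where
`d(z, ∅) = ∞`. -/
def HasBoundedOverlapCovering (X : Type) [MetricSpace X] (r : ℝ) : Prop :=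
  ∃ (N : ℕ) (C : ℝ), C < 1 ∧
    ∃ (ι : Type) (_ : Countable ι) (F : ι → Set X),
      (∀ j, MeasurableSet[borel X] (F j)) ∧
      (∀ i j, i ≠ j → Disjoint (F i) (F j)) ∧
      (⋃ j, F j) = Set.univ ∧
      (∀ x : X, {j : ι | x ∈ {z : X | Metric.infEDist z (F j) ≤ ENNReal.ofReal r}}.encard ≤ N) ∧
      ⨆ j, Metric.ediam (F j) < ENNReal.ofReal C

/-! ### Distance between lines of a complex inner product space -/

section Lines

variable {E : Type*} [NormedAddCommGroup E] [InnerProductSpace ℂ E]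

/-! By the reproducing property, `skwarczynskiDist` is a distance between the complex lines spanned
by the kernel functions in L². Its triangle inequality is inherited from the Hilbert space, and it
separates points because a bounded domain has 1, z₁ and z₂ in its Bergman space.

The covering rests on a count of mass. Take a maximal ε-separated set S, with ε small against 1 - r,
and make the ε-balls around S disjoint; the overlap at x is then at most the number of s ∈ S with
d(x, s) ≤ ρ, for some ρ < 1. Suppose each s has a neighbourhood P_s inside its ε/2-ball with
vol(P_s) K(w, w) ≥ κ for w ∈ P_s. These sets are disjoint, and |K(w, x)|² ≥ (1 - (ρ + ε)²)² K(x, x)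
K(w, w) on them, so each takes a fixed fraction of ∫ |K(·, x)|² = K(x, x). Hence there are boundedly
many (`packing_bound`).

What is special to the Thullen domain is the construction of P_s, uniform in s
(`exists_thullen_packing_sets`). It uses the closed form of the kernel
(`isBergmanKernel_thullenKernel`), found on the axis z₂ = 0 by power series and carried elsewhere by
automorphisms. With l = 1 - |x₂|² and h = 1 - |x₁|² l^(-α), K(x, x) is comparable to l^(-(2+α))
h^(-3). A sheared polydisc with radii c h l^(α/2) and c √h l has the reciprocal volume up to
constants, and the kernel varies little on it when c is small. -/

theorem norm_sub_smul_sq_of_unit {a b : E} (ha : ‖a‖ = 1) (hb : ‖b‖ = 1) {l : ℂ} (hl : ‖l‖ = 1) :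
    ‖a - l • b‖ ^ 2 = 2 - 2 * (l * inner ℂ a b).re := by
  rw [@norm_sub_sq ℂ, norm_smul, inner_smul_right, ha, hb, hl]
  simp only [RCLike.re_to_complex]
  ring

theorem exists_unit_mul_eq_norm (c : ℂ) : ∃ l : ℂ, ‖l‖ = 1 ∧ l * c = ‖c‖ := by
  by_cases hc : c = 0
  · exact ⟨1, by simp, by simp [hc]⟩
  · have hc' : (‖c‖ : ℂ) ≠ 0 := by simpa using hc
    refine ⟨(starRingEnd ℂ) c / ‖c‖, ?_, ?_⟩
    · rw [norm_div, RCLike.norm_conj, Complex.norm_real, norm_norm, div_self (by simpa using hc)]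
    · rw [div_mul_eq_mul_div, mul_comm, Complex.mul_conj, Complex.normSq_eq_norm_sq]
      push_cast
      field_simp

/-- A phase that makes the inner product real and nonnegative minimises the distance. So 2 (1 - |⟨a,
b⟩|) is the squared distance between the unit circles of two lines. -/
theorem exists_norm_sub_smul_sq_eq {a b : E} (ha : ‖a‖ = 1) (hb : ‖b‖ = 1) :
    ∃ l : ℂ, ‖l‖ = 1 ∧ ‖a - l • b‖ ^ 2 = 2 * (1 - ‖inner ℂ a b‖) := by
  obtain ⟨l, hl, h⟩ := exists_unit_mul_eq_norm (inner ℂ a b)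
  refine ⟨l, hl, ?_⟩
  rw [norm_sub_smul_sq_of_unit ha hb hl, h, Complex.ofReal_re]
  ring

theorem le_norm_sub_smul_sq {a b : E} (ha : ‖a‖ = 1) (hb : ‖b‖ = 1) {l : ℂ} (hl : ‖l‖ = 1) :
    2 * (1 - ‖inner ℂ a b‖) ≤ ‖a - l • b‖ ^ 2 := by
  rw [norm_sub_smul_sq_of_unit ha hb hl]
  have := Complex.re_le_norm (l * inner ℂ a b)
  rw [norm_mul, hl, one_mul] at this
  linarith

/-- Optimal phases for (a, b) and (b, c) compose to an admissible, perhaps not optimal, phase for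
(a, c); the norm triangle inequality then applies. -/
theorem sqrt_one_sub_norm_inner_triangle {a b c : E} (ha : ‖a‖ = 1) (hb : ‖b‖ = 1)
    (hc : ‖c‖ = 1) :
    √(1 - ‖inner ℂ a c‖) ≤ √(1 - ‖inner ℂ a b‖) + √(1 - ‖inner ℂ b c‖) := by
  obtain ⟨l, hl, h1⟩ := exists_norm_sub_smul_sq_eq ha hb
  obtain ⟨m, hm, h2⟩ := exists_norm_sub_smul_sq_eq hb hc
  have h3 := le_norm_sub_smul_sq ha hc (l := l * m) (by simp [hl, hm])
  have h4 : ‖a - (l * m) • c‖ ≤ ‖a - l • b‖ + ‖b - m • c‖ := by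
    calc ‖a - (l * m) • c‖ = ‖(a - l • b) + l • (b - m • c)‖ := by
          congr 1; rw [smul_sub, smul_smul]; abel
      _ ≤ _ := (norm_add_le _ _).trans (by rw [norm_smul, hl, one_mul])
  have e1 : √2 * √(1 - ‖inner ℂ a b‖) = ‖a - l • b‖ := by
    rw [← Real.sqrt_mul (by norm_num), ← h1, Real.sqrt_sq (norm_nonneg _)]
  have e2 : √2 * √(1 - ‖inner ℂ b c‖) = ‖b - m • c‖ := by
    rw [← Real.sqrt_mul (by norm_num), ← h2, Real.sqrt_sq (norm_nonneg _)]
  have e3 : √2 * √(1 - ‖inner ℂ a c‖) ≤ ‖a - (l * m) • c‖ := by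
    rw [← Real.sqrt_mul (by norm_num)]
    exact Real.sqrt_le_iff.mpr ⟨norm_nonneg _, h3⟩
  have h2 : 0 < √(2 : ℝ) := by positivity
  refine le_of_mul_le_mul_left ?_ h2
  rw [mul_add, e1, e2]
  exact e3.trans h4

theorem norm_inner_normalize (a b : E) :
    ‖inner ℂ ((‖a‖⁻¹ : ℂ) • a) ((‖b‖⁻¹ : ℂ) • b)‖ = ‖inner ℂ a b‖ / (‖a‖ * ‖b‖) := by
  rw [inner_smul_left, inner_smul_right, norm_mul, norm_mul, RCLike.norm_conj]
  simp only [norm_inv, Complex.norm_real, norm_norm]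
  rw [div_eq_mul_inv, mul_inv]
  ring

theorem norm_normalize {a : E} (ha : a ≠ 0) : ‖(‖a‖⁻¹ : ℂ) • a‖ = 1 := by
  rw [norm_smul, norm_inv, Complex.norm_real, norm_norm, inv_mul_cancel₀ (norm_ne_zero_iff.mpr ha)]

/-- The distance between the complex lines spanned by two nonzero vectors. -/
noncomputable def lineDist (a b : E) : ℝ := √(1 - ‖inner ℂ a b‖ / (‖a‖ * ‖b‖))

theorem lineDist_self {a : E} (ha : a ≠ 0) : lineDist a a = 0 := by
  have : ‖a‖ ≠ 0 := norm_ne_zero_iff.mpr ha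
  rw [lineDist, inner_self_eq_norm_sq_to_K]
  simp only [Complex.coe_algebraMap, norm_pow, Complex.norm_real, norm_norm]
  rw [← sq, div_self (by positivity)]
  simp

theorem lineDist_comm (a b : E) : lineDist a b = lineDist b a := by
  rw [lineDist, lineDist, norm_inner_symm, mul_comm]

theorem lineDist_triangle {a b c : E} (ha : a ≠ 0) (hb : b ≠ 0) (hc : c ≠ 0) :
    lineDist a c ≤ lineDist a b + lineDist b c := by
  have := sqrt_one_sub_norm_inner_triangle (norm_normalize ha) (norm_normalize hb)
    (norm_normalize hc)
  simp only [norm_inner_normalize] at this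
  exact this

theorem exists_smul_eq_of_lineDist_eq_zero {a b : E} (ha : a ≠ 0) (hb : b ≠ 0)
    (h : lineDist a b = 0) : ∃ c : ℂ, a = c • b := by
  have h1 : 1 - ‖inner ℂ a b‖ / (‖a‖ * ‖b‖) ≤ 0 := Real.sqrt_eq_zero'.mp h
  obtain ⟨l, hl, h2⟩ := exists_norm_sub_smul_sq_eq (norm_normalize ha) (norm_normalize hb)
  rw [norm_inner_normalize] at h2
  have h3 : ‖(‖a‖⁻¹ : ℂ) • a - l • (‖b‖⁻¹ : ℂ) • b‖ = 0 := by
    have := sq_nonneg ‖(‖a‖⁻¹ : ℂ) • a - l • (‖b‖⁻¹ : ℂ) • b‖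
    exact pow_eq_zero_iff (two_ne_zero) |>.mp (le_antisymm (by linarith) this)
  have h4 := sub_eq_zero.mp (norm_eq_zero.mp h3)
  refine ⟨‖a‖ * (l * (‖b‖⁻¹ : ℂ)), ?_⟩
  have : (‖a‖ : ℂ) ≠ 0 := by simpa using ha
  rw [mul_smul, mul_smul, ← h4, smul_smul, mul_inv_cancel₀ this, one_smul]

end Lines

/-! ### The Skwarczyński distance as a distance between lines of `L²` -/

section Kernel

variable {Ω : Set (ℂ × ℂ)} {K : ℂ × ℂ → ℂ × ℂ → ℂ}

/-- The kernel function `K(·; w̄)` as an element of `L²(Ω)`. -/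
noncomputable def kernelVec (hK : IsBergmanKernel Ω K) (w : Ω) :
    Lp ℂ 2 (volume.restrict Ω) :=
  (hK w w.2).1.2.toLp

theorem inner_toLp_toLp {μ : Measure (ℂ × ℂ)} {f g : ℂ × ℂ → ℂ} (hf : MemLp f 2 μ)
    (hg : MemLp g 2 μ) :
    inner ℂ (hf.toLp f) (hg.toLp g) = ∫ z, g z * (starRingEnd ℂ) (f z) ∂μ := by
  rw [L2.inner_def]
  refine integral_congr_ae ?_
  filter_upwards [hf.coeFn_toLp, hg.coeFn_toLp] with z h1 h2
  rw [h1, h2]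
  rfl

theorem inner_kernelVec_toLp (hK : IsBergmanKernel Ω K) (w : Ω) {f : ℂ × ℂ → ℂ}
    (hf : MemBergmanSpace Ω f) : inner ℂ (kernelVec hK w) (hf.2.toLp f) = f w := by
  rw [kernelVec, inner_toLp_toLp, (hK w w.2).2 f hf]

theorem inner_kernelVec (hK : IsBergmanKernel Ω K) (z w : Ω) :
    inner ℂ (kernelVec hK z) (kernelVec hK w) = K z w :=
  inner_kernelVec_toLp hK z (hK w w.2).1

theorem kernel_self_eq (hK : IsBergmanKernel Ω K) (z : Ω) :
    K z z = ((‖kernelVec hK z‖ ^ 2 : ℝ) : ℂ) := by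
  rw [← inner_kernelVec hK, inner_self_eq_norm_sq_to_K]
  norm_cast

theorem sqrt_kernel_self_re (hK : IsBergmanKernel Ω K) (z : Ω) :
    √(K z z).re = ‖kernelVec hK z‖ := by
  rw [kernel_self_eq hK, Complex.ofReal_re, Real.sqrt_sq (norm_nonneg _)]

theorem skwarczynskiDist_eq_lineDist (hK : IsBergmanKernel Ω K) (z w : Ω) :
    skwarczynskiDist Ω z w = lineDist (kernelVec hK z) (kernelVec hK w) := by
  rw [skwarczynskiDist, bergmanKernel_eq hK z.2 w.2, bergmanKernel_eq hK z.2 z.2,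
    bergmanKernel_eq hK w.2 w.2, sqrt_kernel_self_re hK, sqrt_kernel_self_re hK, lineDist,
    inner_kernelVec]

theorem memBergmanSpace_of_bounded (hΩ : MeasurableSet Ω) (hv : volume Ω ≠ ⊤) {f : ℂ × ℂ → ℂ}
    (hf : DifferentiableOn ℂ f Ω) (C : ℝ) (hC : ∀ z ∈ Ω, ‖f z‖ ≤ C) : MemBergmanSpace Ω f := by
  have : IsFiniteMeasure (volume.restrict Ω) := ⟨by simpa using hv.lt_top⟩
  refine ⟨hf, MemLp.of_bound (hf.continuousOn.aestronglyMeasurable hΩ) C ?_⟩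
  exact (ae_restrict_iff' hΩ).mpr (Filter.Eventually.of_forall hC)

theorem kernelVec_ne_zero (hΩ : MeasurableSet Ω) (hv : volume Ω ≠ ⊤)
    (hK : IsBergmanKernel Ω K) (z : Ω) : kernelVec hK z ≠ 0 := by
  intro h
  have h1 := inner_kernelVec_toLp hK z
    (memBergmanSpace_of_bounded hΩ hv (differentiableOn_const (1 : ℂ)) 1 (by simp))
  rw [h, inner_zero_left] at h1
  exact zero_ne_one h1

/-- Proportional kernel functions give proportional evaluations. Testing on 1 makes the factor 1,
and testing on the two coordinates identifies the points. -/
theorem eq_of_kernelVec_eq_smul (hΩ : MeasurableSet Ω) (hb : Bornology.IsBounded Ω)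
    (hK : IsBergmanKernel Ω K) {z w : Ω} {c : ℂ} (h : kernelVec hK z = c • kernelVec hK w) :
    z = w := by
  have hv : volume Ω ≠ ⊤ := hb.measure_lt_top.ne
  obtain ⟨C, hC⟩ := hb.exists_norm_le
  have key : ∀ {f : ℂ × ℂ → ℂ}, MemBergmanSpace Ω f → f z = (starRingEnd ℂ) c * f w := by
    intro f hf
    rw [← inner_kernelVec_toLp hK z hf, h, inner_smul_left, inner_kernelVec_toLp hK w hf]
  have h0 := key (memBergmanSpace_of_bounded hΩ hv (differentiableOn_const (1 : ℂ)) 1 (by simp))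
  simp only [mul_one] at h0
  have h1 := key (memBergmanSpace_of_bounded hΩ hv differentiable_fst.differentiableOn C
    fun z hz => (norm_fst_le z).trans (hC z hz))
  have h2 := key (memBergmanSpace_of_bounded hΩ hv differentiable_snd.differentiableOn C
    fun z hz => (norm_snd_le z).trans (hC z hz))
  rw [← h0, one_mul] at h1 h2
  exact Subtype.ext (Prod.ext h1 h2)

/-- The Skwarczyński distance of a bounded domain with a Bergman kernel is a metric. -/
@[reducible]
noncomputable def skwarczynskiMetric (hΩ : MeasurableSet Ω) (hb : Bornology.IsBounded Ω)
    (hK : IsBergmanKernel Ω K) : MetricSpace Ω :=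
  have hv : volume Ω ≠ ⊤ := hb.measure_lt_top.ne
  { dist := fun z w => skwarczynskiDist Ω z w
    dist_self := fun z => by
      rw [skwarczynskiDist_eq_lineDist hK, lineDist_self (kernelVec_ne_zero hΩ hv hK z)]
    dist_comm := fun z w => by
      rw [skwarczynskiDist_eq_lineDist hK, skwarczynskiDist_eq_lineDist hK, lineDist_comm]
    dist_triangle := fun x y z => by
      simp only [skwarczynskiDist_eq_lineDist hK]
      exact lineDist_triangle (kernelVec_ne_zero hΩ hv hK x) (kernelVec_ne_zero hΩ hv hK y)
        (kernelVec_ne_zero hΩ hv hK z)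
    eq_of_dist_eq_zero := fun {x y} h => by
      rw [skwarczynskiDist_eq_lineDist hK] at h
      obtain ⟨c, hc⟩ := exists_smul_eq_of_lineDist_eq_zero (kernelVec_ne_zero hΩ hv hK x)
        (kernelVec_ne_zero hΩ hv hK y) h
      exact eq_of_kernelVec_eq_smul hΩ hb hK hc }

theorem skwarczynskiMetric_dist (hΩ : MeasurableSet Ω) (hb : Bornology.IsBounded Ω)
    (hK : IsBergmanKernel Ω K) (z w : Ω) :
    (skwarczynskiMetric hΩ hb hK).dist z w = skwarczynskiDist Ω z w := rfl

end Kernel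

/-! ### Coverings from packing bounds -/

theorem exists_maximal_separated {X : Type*} [PseudoMetricSpace X] {ε : ℝ} (hε : 0 < ε) :
    ∃ S : Set X, (S.Pairwise fun x y => ε ≤ dist x y) ∧ ∀ x, ∃ s ∈ S, dist x s < ε := by
  obtain ⟨S, hS⟩ := zorn_subset {S : Set X | S.Pairwise fun x y => ε ≤ dist x y} (by
    intro c hc hchain
    refine ⟨⋃₀ c, ?_, fun s hs => Set.subset_sUnion_of_mem hs⟩
    exact (Set.pairwise_sUnion hchain.directedOn).mpr fun s hs => hc hs)
  refine ⟨S, hS.prop, fun x => ?_⟩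
  by_contra! h
  have hx : insert x S ∈ {S : Set X | S.Pairwise fun x y => ε ≤ dist x y} := by
    refine Set.pairwise_insert.mpr ⟨hS.prop, fun y hy _ => ⟨h y hy, ?_⟩⟩
    rw [dist_comm]
    exact h y hy
  have : x ∈ S := hS.le_of_ge hx (Set.subset_insert x S) (Set.mem_insert x S)
  have := h x this
  rw [dist_self] at this
  linarith

theorem hasBoundedOverlapCovering_of_packing {X : Type} [MetricSpace X] {r : ℝ} (hr0 : 0 ≤ r)
    (hr1 : r < 1)
    (hpack : ∀ ε > 0, ∀ ρ : ℝ, ρ + ε < 1 → ∃ N : ℕ, ∀ S : Set X,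
      (S.Pairwise fun x y => ε ≤ dist x y) →
        S.Countable ∧ ∀ x, {s | s ∈ S ∧ dist x s ≤ ρ}.encard ≤ N) :
    HasBoundedOverlapCovering X r := by
  -- With this ε the packing radius r + 2ε still satisfies (r + 2ε) + ε < 1. One ε is the radius of
  -- the balls, the other pays for the infimum in `Metric.infEDist`, which need not be attained.
  obtain ⟨ε, hε⟩ : ∃ ε, ε = (1 - r) / 4 := ⟨_, rfl⟩
  have hε0 : 0 < ε := by linarith
  obtain ⟨N, hN⟩ := hpack ε hε0 (r + 2 * ε) (by linarith)
  obtain ⟨S, hsep, hcov⟩ := exists_maximal_separated (X := X) hε0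
  obtain ⟨hScount, hSN⟩ := hN S hsep
  have : Countable S := hScount
  obtain ⟨e, he⟩ := exists_injective_nat S
  -- Each ball loses the balls that come earlier in the enumeration `e`. Diameters are at most 2ε =
  -- (1 - r)/2 ≤ 1/2, so any constant in (1/2, 1) serves.
  refine ⟨N, 3 / 4, by norm_num, S, this,
    fun s => Metric.ball (s : X) ε \ ⋃ t : {t : S // e t < e s}, Metric.ball (t : X) ε,
    ?_, ?_, ?_, ?_, ?_⟩
  · intro s
    borelize X
    exact Metric.isOpen_ball.measurableSet.diff
      (isOpen_iUnion fun t => Metric.isOpen_ball).measurableSet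
  · have key : ∀ s t : S, e s < e t → Disjoint
        (Metric.ball (s : X) ε \ ⋃ t : {t : S // e t < e s}, Metric.ball (t : X) ε)
        (Metric.ball (t : X) ε \ ⋃ u : {u : S // e u < e t}, Metric.ball (u : X) ε) := by
      intro s t hst
      refine Set.disjoint_left.mpr fun x hx hx' => hx'.2 ?_
      exact Set.mem_iUnion.mpr ⟨⟨s, hst⟩, hx.1⟩
    intro s t hst
    rcases lt_or_gt_of_ne (fun h => hst (he h)) with h | h
    · exact key s t h
    · exact (key t s h).symm
  · refine Set.eq_univ_of_forall fun x => ?_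
    have hx : ∃ n, ∃ s : S, e s = n ∧ x ∈ Metric.ball (s : X) ε := by
      obtain ⟨s, hs, h⟩ := hcov x
      exact ⟨_, ⟨s, hs⟩, rfl, h⟩
    classical
    obtain ⟨s, hs, hxs⟩ := Nat.find_spec hx
    refine Set.mem_iUnion.mpr ⟨s, hxs, fun h => ?_⟩
    obtain ⟨⟨t, ht⟩, hxt⟩ := Set.mem_iUnion.mp h
    rw [hs] at ht
    exact Nat.find_min hx ht ⟨t, rfl, hxt⟩
  · intro x
    refine le_trans ?_ (hSN x)
    rw [← Subtype.val_injective.encard_image]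
    refine Set.encard_le_encard ?_
    rintro _ ⟨s, hs, rfl⟩
    refine ⟨s.2, ?_⟩
    have h1 : Metric.infEDist x (Metric.ball (s : X) ε \
        ⋃ t : {t : S // e t < e s}, Metric.ball (t : X) ε) < ENNReal.ofReal (r + ε) :=
      lt_of_le_of_lt hs ((ENNReal.ofReal_lt_ofReal_iff (by linarith)).mpr (by linarith))
    obtain ⟨w, hw, hxw⟩ := Metric.infEDist_lt_iff.mp h1
    have h2 : dist w s < ε := hw.1
    have h3 : dist x w < r + ε := by
      rw [edist_dist] at hxw
      exact (ENNReal.ofReal_lt_ofReal_iff (by linarith)).mp hxw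
    have := dist_triangle x w s
    change dist x s ≤ _
    linarith
  · refine lt_of_le_of_lt (b := ENNReal.ofReal (2 * ε)) (iSup_le fun s => ?_)
      ((ENNReal.ofReal_lt_ofReal_iff (by norm_num)).mpr (by linarith))
    refine Metric.ediam_le fun x hx y hy => ?_
    rw [edist_dist]
    refine ENNReal.ofReal_le_ofReal ?_
    have h1 : dist x s < ε := hx.1
    have h2 : dist y s < ε := hy.1
    have := dist_triangle_right x y s
    linarith

/-! ### Packing bounds from the reproducing property -/

section Packing

variable {Ω : Set (ℂ × ℂ)} {K : ℂ × ℂ → ℂ × ℂ → ℂ}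

theorem integrableOn_norm_kernel_sq (hK : IsBergmanKernel Ω K) (x : Ω) :
    IntegrableOn (fun z => ‖K z x‖ ^ 2) Ω :=
  (hK x x.2).1.2.integrable_norm_pow (by norm_num)

theorem integral_norm_kernel_sq (hK : IsBergmanKernel Ω K) (x : Ω) :
    ∫ z in Ω, ‖K z x‖ ^ 2 = ‖kernelVec hK x‖ ^ 2 := by
  have h := (hK x x.2).2 _ (hK x x.2).1
  rw [kernel_self_eq hK] at h
  have h2 : ∀ z, K z x * (starRingEnd ℂ) (K z x) = ((‖K z x‖ ^ 2 : ℝ) : ℂ) := by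
    intro z
    rw [Complex.mul_conj, Complex.normSq_eq_norm_sq]
  simp only [h2] at h
  rw [integral_complex_ofReal] at h
  exact_mod_cast h.symm

theorem le_norm_kernel_sq_of_skwarczynskiDist_le (hΩ : MeasurableSet Ω) (hv : volume Ω ≠ ⊤)
    (hK : IsBergmanKernel Ω K) {x w : Ω} {ρ : ℝ} (hρ : 0 ≤ ρ) (hρ1 : ρ < 1)
    (h : skwarczynskiDist Ω x w ≤ ρ) :
    (1 - ρ ^ 2) ^ 2 * (‖kernelVec hK x‖ ^ 2 * ‖kernelVec hK w‖ ^ 2) ≤ ‖K w x‖ ^ 2 := by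
  rw [skwarczynskiDist_eq_lineDist hK, lineDist, Real.sqrt_le_left hρ, norm_inner_symm,
    inner_kernelVec hK] at h
  have hx : 0 < ‖kernelVec hK x‖ := norm_pos_iff.mpr (kernelVec_ne_zero hΩ hv hK x)
  have hw : 0 < ‖kernelVec hK w‖ := norm_pos_iff.mpr (kernelVec_ne_zero hΩ hv hK w)
  have h1 : 1 - ρ ^ 2 ≤ ‖K w x‖ / (‖kernelVec hK x‖ * ‖kernelVec hK w‖) := by linarith
  rw [le_div_iff₀ (by positivity)] at h1
  have h2 : 0 ≤ 1 - ρ ^ 2 := by nlinarith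
  rw [← mul_pow, ← mul_pow]
  exact pow_le_pow_left₀ (by positivity) h1 2

/-- The total mass ∫ |K(·, x)|² = K(x, x) is shared among disjoint sets, each of which carries at
least (1 - (ρ + ε)²)² κ K(x, x). -/
theorem packing_bound (hΩ : MeasurableSet Ω) (hb : Bornology.IsBounded Ω)
    (hK : IsBergmanKernel Ω K)
    (hP : ∀ ε > 0, ∃ κ > 0, ∀ x : Ω, ∃ P ⊆ Ω, MeasurableSet P ∧
      (∀ w ∈ P, skwarczynskiDist Ω x w < ε) ∧ 0 < volume.real P ∧
      ∀ w ∈ P, κ ≤ volume.real P * (K w w).re) :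
    ∀ ε > 0, ∀ ρ : ℝ, ρ + ε < 1 → ∃ N : ℕ, ∀ S : Set Ω,
      (S.Pairwise fun x y => ε ≤ skwarczynskiDist Ω x y) →
        S.Countable ∧ ∀ x : Ω, {s : Ω | s ∈ S ∧ skwarczynskiDist Ω x s ≤ ρ}.encard ≤ N := by
  intro ε hε ρ hρ
  have hv : volume Ω ≠ ⊤ := hb.measure_lt_top.ne
  obtain ⟨κ, hκ, hP⟩ := hP (ε / 2) (by linarith)
  choose P hPΩ hPm hPd hPv hPκ using hP
  let m := skwarczynskiMetric hΩ hb hK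
  have dtri : ∀ x y z : Ω, skwarczynskiDist Ω x z ≤
      skwarczynskiDist Ω x y + skwarczynskiDist Ω y z := m.dist_triangle
  have dcomm : ∀ x y : Ω, skwarczynskiDist Ω x y = skwarczynskiDist Ω y x := m.dist_comm
  -- The maximum covers negative ρ, for which no point s qualifies; as soon as one does, ρ ≥ 0 and
  -- the maximum is ρ.
  obtain ⟨N, hN⟩ := exists_nat_ge (1 / ((1 - (max ρ 0 + ε) ^ 2) ^ 2 * κ))
  refine ⟨N, fun S hS => ?_⟩
  -- Each P s lies in the open ε/2-ball of s, and the centres are ε apart.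
  have hdisj : ∀ s ∈ S, ∀ t ∈ S, s ≠ t → Disjoint (P s) (P t) := by
    intro s hs t ht hst
    refine Set.disjoint_left.mpr fun w hw hw' => ?_
    have h1 := hPd s w hw
    have h2 := hPd t w hw'
    have h3 := dtri s ⟨w, hPΩ s hw⟩ t
    have h4 := hS hs ht hst
    rw [dcomm ⟨w, hPΩ s hw⟩ t] at h3
    simp only at h3
    linarith
  refine ⟨?_, fun x => ?_⟩
  · have h := Measure.countable_meas_pos_of_disjoint_iUnion (μ := (volume : Measure (ℂ × ℂ)))
      (As := fun s : S => P s) (fun s => hPm s)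
      (fun s t hst => hdisj s s.2 t t.2 fun h => hst (Subtype.ext h))
    have h2 : {s : S | 0 < volume (P s)} = Set.univ := by
      refine Set.eq_univ_of_forall fun s => ?_
      exact (ENNReal.toReal_pos_iff.mp (hPv s)).1
    rw [h2] at h
    exact Set.countable_coe_iff.mp (Set.countable_univ_iff.mp h)
  · set M := {s : Ω | s ∈ S ∧ skwarczynskiDist Ω x s ≤ ρ} with hM
    by_contra! hcard
    obtain ⟨T, hTM, hTc⟩ := Set.exists_subset_encard_eq (Order.add_one_le_of_lt hcard)
    have hTfin : T.Finite := Set.finite_of_encard_eq_coe (k := N + 1) (by rw [hTc]; rfl)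
    lift T to Finset Ω using hTfin
    rw [Set.encard_coe_eq_coe_finsetCard] at hTc
    have hTc' : T.card = N + 1 := by exact_mod_cast hTc
    have hTne : T.Nonempty := Finset.card_pos.mp (by omega)
    obtain ⟨s₀, hs₀⟩ := hTne
    have hρ0 : 0 ≤ ρ := le_trans (Real.sqrt_nonneg _) (hTM hs₀).2
    rw [max_eq_left hρ0] at hN
    set δ := 1 - (ρ + ε) ^ 2 with hδ
    have hδ0 : 0 < δ := by nlinarith
    have hkx : 0 < ‖kernelVec hK x‖ := norm_pos_iff.mpr (kernelVec_ne_zero hΩ hv hK x)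
    have hint := integrableOn_norm_kernel_sq hK x
    have hlow : ∀ s ∈ T, δ ^ 2 * ‖kernelVec hK x‖ ^ 2 * κ ≤ ∫ z in P s, ‖K z x‖ ^ 2 := by
      intro s hs
      have hpt : ∀ w ∈ P s, δ ^ 2 * ‖kernelVec hK x‖ ^ 2 * κ / volume.real (P s) ≤
          ‖K w x‖ ^ 2 := by
        intro w hw
        have hd : skwarczynskiDist Ω x w ≤ ρ + ε := by
          have h1 := dtri x s ⟨w, hPΩ s hw⟩
          have h2 := (hTM hs).2
          have h3 := hPd s w hw
          simp only at h1
          linarith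
        have h1 := le_norm_kernel_sq_of_skwarczynskiDist_le hΩ hv hK (x := x)
          (w := ⟨w, hPΩ s hw⟩) (by linarith) hρ hd
        have h2 := hPκ s w hw
        have h3 := kernel_self_eq hK ⟨w, hPΩ s hw⟩
        simp only at h3
        rw [h3, Complex.ofReal_re] at h2
        refine le_trans ?_ h1
        rw [div_le_iff₀ (hPv s), mul_assoc, mul_assoc, mul_assoc]
        have : 0 < δ ^ 2 := by positivity
        refine mul_le_mul_of_nonneg_left (mul_le_mul_of_nonneg_left ?_ (by positivity)) this.le
        rw [mul_comm]
        exact h2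
      have hfin : volume (P s) ≠ ⊤ := ((measure_mono (hPΩ s)).trans_lt hv.lt_top).ne
      have := setIntegral_ge_of_const_le_real (hPm s) hfin hpt (hint.mono_set (hPΩ s))
      rwa [div_mul_cancel₀ _ (hPv s).ne'] at this
    have hsum : ∑ s ∈ T, ∫ z in P s, ‖K z x‖ ^ 2 ≤ ‖kernelVec hK x‖ ^ 2 := by
      rw [← integral_biUnion_finset T (fun s _ => hPm s)
        (fun s hs t ht hst => hdisj s (hTM hs).1 t (hTM ht).1 hst)
        (fun s _ => hint.mono_set (hPΩ s)), ← integral_norm_kernel_sq hK]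
      refine setIntegral_mono_set hint ?_ ?_
      · exact Filter.Eventually.of_forall fun z => by positivity
      · exact (Set.iUnion₂_subset fun s _ => hPΩ s).eventuallyLE
    have h1 := (Finset.sum_le_sum hlow).trans hsum
    rw [Finset.sum_const, hTc', nsmul_eq_mul] at h1
    rw [div_le_iff₀ (by positivity)] at hN
    push_cast at h1
    have h2 : 0 < δ ^ 2 * κ := by positivity
    have h3 : 0 < ‖kernelVec hK x‖ ^ 2 := by positivity
    nlinarith

theorem hasBoundedOverlapCovering_skwarczynskiMetric (hΩ : MeasurableSet Ω)
    (hb : Bornology.IsBounded Ω) (hK : IsBergmanKernel Ω K)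
    (hP : ∀ ε > 0, ∃ κ > 0, ∀ x : Ω, ∃ P ⊆ Ω, MeasurableSet P ∧
      (∀ w ∈ P, skwarczynskiDist Ω x w < ε) ∧ 0 < volume.real P ∧
      ∀ w ∈ P, κ ≤ volume.real P * (K w w).re) {r : ℝ} (hr0 : 0 ≤ r) (hr1 : r < 1) :
    @HasBoundedOverlapCovering Ω (skwarczynskiMetric hΩ hb hK) r := by
  let := skwarczynskiMetric hΩ hb hK
  exact hasBoundedOverlapCovering_of_packing hr0 hr1 (packing_bound hΩ hb hK hP)

end Packing

/-! ### Radial integrals of holomorphic functions on discs -/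

/-- On the circle of radius r, conj(z)^n = r^(2n) z^(-n), which turns this into Cauchy's formula for
the n-th Taylor coefficient. Periodicity moves the interval to (-π, π), as polar coordinates
require. -/
theorem integral_circleMap_mul_conj_pow {F : ℂ → ℂ} {R r : ℝ} (n : ℕ) (hr : 0 < r) (hrR : r < R)
    (hF : DifferentiableOn ℂ F (Metric.ball 0 R)) :
    ∫ θ in Set.Ioo (-Real.pi) Real.pi,
      (starRingEnd ℂ) (circleMap 0 r θ) ^ n * F (circleMap 0 r θ) =
      2 * Real.pi * r ^ (2 * n) * (iteratedDeriv n F 0 / n.factorial) := by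
  have h := (hF.mono (Metric.closedBall_subset_ball hrR)).circleIntegral_one_div_sub_center_pow_smul
    hr n
  rw [circleIntegral] at h
  simp only [deriv_circleMap, sub_zero, smul_eq_mul] at h
  have hpt : ∀ θ : ℝ, circleMap 0 r θ * Complex.I *
      (1 / circleMap 0 r θ ^ (n + 1) * F (circleMap 0 r θ)) =
      Complex.I / r ^ (2 * n) * ((starRingEnd ℂ) (circleMap 0 r θ) ^ n * F (circleMap 0 r θ)) := by
    intro θ
    have h1 : circleMap 0 r θ ≠ 0 := circleMap_ne_center hr.ne'
    have h2 : (r : ℂ) ≠ 0 := by exact_mod_cast hr.ne'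
    have h3 : (r : ℂ) ^ (2 * n) = circleMap 0 r θ ^ n * (starRingEnd ℂ) (circleMap 0 r θ) ^ n := by
      rw [← mul_pow, Complex.mul_conj, Complex.normSq_eq_norm_sq, norm_circleMap_zero, pow_mul,
        sq_abs]
      push_cast
      rfl
    have h4 : (starRingEnd ℂ) (circleMap 0 r θ) ≠ 0 := by simpa using h1
    rw [h3]
    field_simp
    ring
  simp only [hpt] at h
  rw [intervalIntegral.integral_const_mul] at h
  have hper : Function.Periodic
      (fun θ => (starRingEnd ℂ) (circleMap 0 r θ) ^ n * F (circleMap 0 r θ)) (2 * Real.pi) := by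
    intro θ
    simp only [periodic_circleMap 0 r θ]
  have hshift := hper.intervalIntegral_add_eq 0 (-Real.pi)
  rw [zero_add, show -Real.pi + 2 * Real.pi = Real.pi by ring] at hshift
  rw [hshift, intervalIntegral.integral_of_le (by linarith [Real.pi_pos]),
    integral_Ioc_eq_integral_Ioo] at h
  have h2 : (r : ℂ) ^ (2 * n) ≠ 0 := pow_ne_zero _ (by exact_mod_cast hr.ne')
  have hI := Complex.I_ne_zero
  rw [div_mul_eq_mul_div, div_eq_iff h2] at h
  refine mul_left_cancel₀ hI (h.trans ?_)
  ring

theorem integral_eq_integral_polar {G : ℂ → ℂ} (hGm : Measurable G) (hG : Integrable G) :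
    ∫ z, G z = ∫ r in Set.Ioi (0 : ℝ), ∫ θ in Set.Ioo (-Real.pi) Real.pi,
      (r : ℂ) * G (circleMap 0 r θ) := by
  have hsymm : ∀ p : ℝ × ℝ, Complex.polarCoord.symm p = circleMap 0 p.1 p.2 := by
    intro p
    rw [Complex.polarCoord_symm_apply, circleMap, Complex.exp_mul_I]
    push_cast
    ring
  have hc : Continuous fun p : ℝ × ℝ => circleMap 0 p.1 p.2 := by
    unfold circleMap
    fun_prop
  have hI : IntegrableOn (fun p : ℝ × ℝ => (p.1 : ℂ) * G (circleMap 0 p.1 p.2))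
      (Set.Ioi (0 : ℝ) ×ˢ Set.Ioo (-Real.pi) Real.pi) (volume.prod volume) := by
    refine ⟨?_, ?_⟩
    · exact ((Complex.measurable_ofReal.comp measurable_fst).mul
        (hGm.comp hc.measurable)).aestronglyMeasurable
    · have h := hG.2
      rw [HasFiniteIntegral, ← Complex.lintegral_comp_polarCoord_symm] at h
      refine lt_of_eq_of_lt ?_ h
      refine setLIntegral_congr_fun (measurableSet_Ioi.prod measurableSet_Ioo) fun p hp => ?_
      have hp1 : (0 : ℝ) < p.1 := hp.1
      simp only [hsymm, enorm_mul, smul_eq_mul]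
      congr 1
      rw [← ofReal_norm, Complex.norm_real, Real.norm_of_nonneg hp1.le]
  rw [← setIntegral_prod _ hI, ← Complex.integral_comp_polarCoord_symm]
  refine setIntegral_congr_fun (measurableSet_Ioi.prod measurableSet_Ioo) fun p hp => ?_
  simp only [hsymm, Complex.real_smul]

theorem setIntegral_ball_radial {F : ℂ → ℂ} {R : ℝ} (n : ℕ)
    (hF : DifferentiableOn ℂ F (Metric.ball 0 R)) {ω : ℝ → ℝ} (hω : Measurable ω)
    (hI : IntegrableOn (fun z => (ω ‖z‖ : ℂ) * ((starRingEnd ℂ) z ^ n * F z)) (Metric.ball 0 R)) :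
    ∫ z in Metric.ball 0 R, (ω ‖z‖ : ℂ) * ((starRingEnd ℂ) z ^ n * F z) =
      (iteratedDeriv n F 0 / n.factorial) *
        (2 * Real.pi * ∫ r in Set.Ioo 0 R, ω r * r ^ (2 * n + 1) : ℝ) := by
  set G : ℂ → ℂ := (Metric.ball 0 R).indicator fun z => (ω ‖z‖ : ℂ) * ((starRingEnd ℂ) z ^ n * F z)
    with hG
  -- Nothing is known about F outside the disc, so it is cut off before measurability is claimed.
  have hFm : Measurable ((Metric.ball (0 : ℂ) R).indicator F) := by
    classical
    rw [← Set.piecewise_eq_indicator]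
    exact hF.continuousOn.measurable_piecewise continuousOn_const measurableSet_ball
  have hGm : Measurable G := by
    have : G = fun z => (ω ‖z‖ : ℂ) * ((starRingEnd ℂ) z ^ n *
        (Metric.ball (0 : ℂ) R).indicator F z) := by
      ext z
      by_cases hz : z ∈ Metric.ball (0 : ℂ) R <;> simp [hG, hz]
    rw [this]
    exact (Complex.measurable_ofReal.comp (hω.comp measurable_norm)).mul
      ((Complex.continuous_conj.measurable.pow_const n).mul hFm)
  have hGI : Integrable G := (integrable_indicator_iff measurableSet_ball).mpr hI
  rw [← integral_indicator measurableSet_ball, ← hG, integral_eq_integral_polar hGm hGI]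
  have hinner : ∀ r ∈ Set.Ioi (0 : ℝ), (∫ θ in Set.Ioo (-Real.pi) Real.pi,
      (r : ℂ) * G (circleMap 0 r θ)) = (Set.Ioo 0 R).indicator (fun r : ℝ =>
        (iteratedDeriv n F 0 / n.factorial) * (2 * Real.pi * (ω r * r ^ (2 * n + 1)) : ℝ)) r := by
    intro r hr
    have hr : 0 < r := hr
    by_cases hrR : r < R
    · have hGv : ∀ θ, (r : ℂ) * G (circleMap 0 r θ) = (r * ω r : ℂ) *
          ((starRingEnd ℂ) (circleMap 0 r θ) ^ n * F (circleMap 0 r θ)) := by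
        intro θ
        have : circleMap 0 r θ ∈ Metric.ball (0 : ℂ) R := by
          simpa [abs_of_pos hr] using hrR
        rw [hG, Set.indicator_of_mem this, norm_circleMap_zero, abs_of_pos hr]
        ring
      simp only [hGv]
      rw [integral_const_mul, integral_circleMap_mul_conj_pow n hr hrR hF,
        Set.indicator_of_mem (show r ∈ Set.Ioo 0 R from ⟨hr, hrR⟩)]
      push_cast
      ring
    · have hGv : ∀ θ, (r : ℂ) * G (circleMap 0 r θ) = 0 := by
        intro θ
        have : circleMap 0 r θ ∉ Metric.ball (0 : ℂ) R := by
          simpa [abs_of_pos hr] using hrR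
        rw [hG, Set.indicator_of_notMem this, mul_zero]
      simp only [hGv, integral_zero]
      rw [Set.indicator_of_notMem fun h => hrR h.2]
  rw [setIntegral_congr_fun measurableSet_Ioi hinner, integral_indicator measurableSet_Ioo,
    Measure.restrict_restrict measurableSet_Ioo, Set.inter_eq_left.mpr fun x hx => hx.1,
    integral_const_mul, integral_complex_ofReal, integral_const_mul]

theorem setIntegral_ball_eq_mul {F : ℂ → ℂ} {R : ℝ} (hR : 0 ≤ R)
    (hF : DifferentiableOn ℂ F (Metric.ball 0 R)) (hI : IntegrableOn F (Metric.ball 0 R)) :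
    ∫ z in Metric.ball 0 R, F z = (Real.pi * R ^ 2 : ℝ) * F 0 := by
  have h := setIntegral_ball_radial (R := R) 0 hF (ω := fun _ => 1) measurable_const
    (by simpa using hI)
  simp only [Complex.ofReal_one, pow_zero, one_mul, mul_zero, zero_add, pow_one,
    iteratedDeriv_zero, Nat.factorial_zero, Nat.cast_one, div_one] at h
  rw [h, ← integral_Ioc_eq_integral_Ioo, ← intervalIntegral.integral_of_le hR, integral_id]
  push_cast
  ring

theorem integral_one_sub_rpow_mul_pow {p : ℝ} (hp : 0 < p) (n : ℕ) :
    ∫ r in Set.Ioo (0 : ℝ) 1, (1 - r ^ p) * r ^ (2 * n + 1) =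
      1 / (2 * n + 2) - 1 / (2 * n + 2 + p) := by
  have h1 : ∀ r ∈ Set.Ioo (0 : ℝ) 1, (1 - r ^ p) * r ^ (2 * n + 1) =
      r ^ (2 * n + 1 : ℝ) - r ^ (2 * n + 1 + p : ℝ) := by
    intro r hr
    have h2 : r ^ (2 * n + 1 : ℝ) = r ^ (2 * n + 1) := by exact_mod_cast Real.rpow_natCast r _
    rw [Real.rpow_add hr.1 (2 * n + 1), h2]
    ring
  have hn : (0 : ℝ) ≤ n := Nat.cast_nonneg n
  rw [setIntegral_congr_fun measurableSet_Ioo h1, ← integral_Ioc_eq_integral_Ioo,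
    ← intervalIntegral.integral_of_le zero_le_one, intervalIntegral.integral_sub,
    integral_rpow (Or.inl (by linarith)), integral_rpow (Or.inl (by linarith)), Real.one_rpow,
    Real.one_rpow, Real.zero_rpow (by positivity), Real.zero_rpow (by positivity)]
  · ring_nf
  · exact intervalIntegral.intervalIntegrable_rpow' (by linarith)
  · exact intervalIntegral.intervalIntegrable_rpow' (by linarith)

/-! ### The Thullen domain and its kernel on the axis -/

theorem isOpen_thullenDomain {α : ℝ} (hα : 0 < α) : IsOpen (thullenDomain α) := by
  have hp : 0 ≤ 2 / α := by positivity
  refine isOpen_lt (Continuous.add ?_ (by fun_prop)) continuous_const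
  exact continuous_fst.norm.rpow_const fun _ => Or.inr hp

theorem norm_fst_lt_one_of_mem {α : ℝ} (hα : 0 < α) {z : ℂ × ℂ} (hz : z ∈ thullenDomain α) :
    ‖z.1‖ < 1 := by
  have h : ‖z.1‖ ^ (2 / α) + ‖z.2‖ ^ 2 < 1 := hz
  by_contra! h1
  have := Real.one_le_rpow h1 (show 0 ≤ 2 / α by positivity)
  nlinarith [sq_nonneg ‖z.2‖]

theorem norm_snd_lt_one_of_mem {α : ℝ} {z : ℂ × ℂ} (hz : z ∈ thullenDomain α) :
    ‖z.2‖ < 1 := by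
  have h : ‖z.1‖ ^ (2 / α) + ‖z.2‖ ^ 2 < 1 := hz
  have h1 : 0 ≤ ‖z.1‖ ^ (2 / α) := Real.rpow_nonneg (norm_nonneg _) _
  by_contra! h2
  nlinarith

theorem isBounded_thullenDomain {α : ℝ} (hα : 0 < α) : Bornology.IsBounded (thullenDomain α) :=
  isBounded_iff_forall_norm_le.mpr ⟨1, fun _ hz => max_le (norm_fst_lt_one_of_mem hα hz).le
    (norm_snd_lt_one_of_mem hz).le⟩

theorem mk_mem_thullenDomain_iff {α : ℝ} {x y : ℂ} :
    (x, y) ∈ thullenDomain α ↔ y ∈ Metric.ball (0 : ℂ) √(1 - ‖x‖ ^ (2 / α)) := by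
  rw [mem_ball_zero_iff, Real.lt_sqrt (norm_nonneg _)]
  change ‖x‖ ^ (2 / α) + ‖y‖ ^ 2 < 1 ↔ _
  constructor <;> intro h <;> linarith

theorem mk_zero_mem_thullenDomain_iff {α : ℝ} (hα : 0 < α) {x : ℂ} :
    (x, (0 : ℂ)) ∈ thullenDomain α ↔ x ∈ Metric.ball (0 : ℂ) 1 := by
  rw [mem_ball_zero_iff]
  refine ⟨norm_fst_lt_one_of_mem hα, fun h => ?_⟩
  change ‖x‖ ^ (2 / α) + ‖(0 : ℂ)‖ ^ 2 < 1
  have := Real.rpow_lt_one (norm_nonneg x) h (show 0 < 2 / α by positivity)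
  simpa using this

/-- The fibre over x is a disc of squared radius 1 - |x|^(2/α) in z₂, so the mean value property
replaces f(x, ·) by π (1 - |x|^(2/α)) f(x, 0). The remaining weight is radial and selects one Taylor
coefficient; the constant is the squared norm of z₁^n. -/
theorem setIntegral_thullenDomain_mul_conj_pow {α : ℝ} (hα : 0 < α) {f : ℂ × ℂ → ℂ}
    (hf : DifferentiableOn ℂ f (thullenDomain α)) (hI : IntegrableOn f (thullenDomain α)) (n : ℕ) :
    ∫ z in thullenDomain α, (starRingEnd ℂ) z.1 ^ n * f z =
      iteratedDeriv n (fun x => f (x, 0)) 0 / n.factorial *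
        (Real.pi ^ 2 / ((n + 1) * (α * (n + 1) + 1)) : ℝ) := by
  have hm := (isOpen_thullenDomain hα).measurableSet
  have hgI : IntegrableOn (fun z : ℂ × ℂ => (starRingEnd ℂ) z.1 ^ n * f z) (thullenDomain α) := by
    refine Integrable.bdd_mul hI (c := 1) ?_ ?_
    · exact ((Complex.continuous_conj.comp continuous_fst).pow n).aestronglyMeasurable
    · refine (ae_restrict_iff' hm).mpr (Filter.Eventually.of_forall fun z hz => ?_)
      rw [norm_pow, RCLike.norm_conj]
      exact pow_le_one₀ (norm_nonneg _) (norm_fst_lt_one_of_mem hα hz).le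
  set G := (thullenDomain α).indicator fun z : ℂ × ℂ => (starRingEnd ℂ) z.1 ^ n * f z with hG
  have hGI : Integrable G (volume.prod volume) := (integrable_indicator_iff hm).mpr hgI
  have hslice : ∀ x y, G (x, y) = (Metric.ball (0 : ℂ) √(1 - ‖x‖ ^ (2 / α))).indicator
      (fun y => (starRingEnd ℂ) x ^ n * f (x, y)) y := by
    intro x y
    by_cases h : (x, y) ∈ thullenDomain α
    · rw [hG, Set.indicator_of_mem h, Set.indicator_of_mem (mk_mem_thullenDomain_iff.mp h)]
    · rw [hG, Set.indicator_of_notMem h,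
        Set.indicator_of_notMem (mt mk_mem_thullenDomain_iff.mpr h)]
  have hinner : ∀ᵐ x : ℂ, ∫ y, G (x, y) = (Metric.ball (0 : ℂ) 1).indicator
      (fun x => ((Real.pi * (1 - ‖x‖ ^ (2 / α)) : ℝ) : ℂ) *
        ((starRingEnd ℂ) x ^ n * f (x, 0))) x := by
    filter_upwards [hGI.prod_right_ae] with x hx
    simp only [hslice] at hx ⊢
    rw [integrable_indicator_iff measurableSet_ball] at hx
    rw [integral_indicator measurableSet_ball, setIntegral_ball_eq_mul (Real.sqrt_nonneg _) _ hx]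
    · by_cases h1 : x ∈ Metric.ball (0 : ℂ) 1
      · rw [Set.indicator_of_mem h1, Real.sq_sqrt]
        have := Real.rpow_le_one (norm_nonneg x) (mem_ball_zero_iff.mp h1).le
          (show 0 ≤ 2 / α by positivity)
        linarith
      -- The radicand is nonpositive here, so its square root is 0 by convention, which agrees with
      -- the empty fibre.
      · rw [Set.indicator_of_notMem h1, Real.sqrt_eq_zero'.mpr]
        · simp
        · rw [mem_ball_zero_iff, not_lt] at h1
          have := Real.one_le_rpow h1 (show 0 ≤ 2 / α by positivity)
          linarith
    · refine DifferentiableOn.const_mul ?_ _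
      refine hf.comp (f := fun y => (x, y)) (by fun_prop) fun y hy => mk_mem_thullenDomain_iff.mpr hy
  have hωI : IntegrableOn (fun x : ℂ => ((Real.pi * (1 - ‖x‖ ^ (2 / α)) : ℝ) : ℂ) *
      ((starRingEnd ℂ) x ^ n * f (x, 0))) (Metric.ball (0 : ℂ) 1) := by
    rw [← integrable_indicator_iff measurableSet_ball]
    exact hGI.integral_prod_left.congr hinner
  rw [← integral_indicator hm, ← hG, Measure.volume_eq_prod, integral_prod _ hGI,
    integral_congr_ae hinner, integral_indicator measurableSet_ball,
    setIntegral_ball_radial (R := 1) n (F := fun x => f (x, 0))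
      (ω := fun r => Real.pi * (1 - r ^ (2 / α)))
      (hf.comp (f := fun x => (x, (0 : ℂ))) (by fun_prop)
        fun x hx => (mk_zero_mem_thullenDomain_iff hα).mpr hx) (by fun_prop) hωI]
  congr 2
  simp only [mul_assoc]
  rw [integral_const_mul, integral_one_sub_rpow_mul_pow (by positivity)]
  have hn : (0 : ℝ) ≤ n := Nat.cast_nonneg n
  have h1 : 0 < α * (n + 1) + 1 := by positivity
  have h2 : 0 < (2 : ℝ) * n + 2 + 2 / α := by positivity
  field_simp
  ring

theorem HasSum.of_forall_eq {f g : ℕ → ℂ} {a : ℂ} (h : HasSum g a) (e : ∀ n, f n = g n) :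
    HasSum f a := by
  rwa [funext e]

/-- The Bergman kernel of the Thullen domain at `(x, 0)` and `(s, 0)`, as a function of `x s̄`. -/
noncomputable def axisKernel (α : ℝ) (y : ℂ) : ℂ :=
  ((α + 1) + (α - 1) * y) / (Real.pi ^ 2 * (1 - y) ^ 3)

/-- The coefficients are the reciprocal squared norms of z₁^n. They are summed by writing
(n+1)(α(n+1)+1) = 2α C(n+2, 2) + (1-α)(n+1). -/
theorem hasSum_axisKernel (α : ℝ) {y : ℂ} (hy : ‖y‖ < 1) :
    HasSum (fun n : ℕ => (((n + 1) * (α * (n + 1) + 1) / Real.pi ^ 2 : ℝ) : ℂ) * y ^ n)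
      (axisKernel α y) := by
  have h1 := hasSum_choose_mul_geometric_of_norm_lt_one 1 hy
  have h2 := hasSum_choose_mul_geometric_of_norm_lt_one 2 hy
  have h3 := ((h2.mul_left (2 * α : ℂ)).add (h1.mul_left (1 - α : ℂ))).mul_left
    ((1 : ℂ) / Real.pi ^ 2)
  have hy1 : 1 - y ≠ 0 := sub_ne_zero.mpr fun h => by simp [← h] at hy
  have hpi : (Real.pi : ℂ) ≠ 0 := by exact_mod_cast Real.pi_ne_zero
  have e : axisKernel α y = 1 / Real.pi ^ 2 * (2 * α * (1 / (1 - y) ^ (2 + 1)) +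
      (1 - α) * (1 / (1 - y) ^ (1 + 1))) := by
    rw [axisKernel]
    field_simp
    ring
  rw [e]
  refine HasSum.of_forall_eq h3 fun n => ?_
  have h4 : (((n + 2).choose 2 : ℕ) : ℂ) * 2 = (n + 2) * (n + 1) := by
    have := Nat.add_one_mul_choose_eq (n + 1) 1
    simp only [Nat.choose_one_right] at this
    have h5 : (n + 2) * (n + 1) = (n + 2).choose 2 * 2 := this
    exact_mod_cast h5.symm
  have h5 : (((n + 1).choose 1 : ℕ) : ℂ) = n + 1 := by simp
  rw [h5]
  push_cast
  linear_combination (-(α : ℂ) * y ^ n / Real.pi ^ 2) * h4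

theorem axisKernel_conj (α : ℝ) (y : ℂ) :
    (starRingEnd ℂ) (axisKernel α y) = axisKernel α ((starRingEnd ℂ) y) := by
  simp [axisKernel]

/-- Integrating the kernel series term by term against f gives the Taylor series of f(·, 0) at s.
The exchange is legitimate because |z₁| < 1 on the domain and the coefficients times s^n are
absolutely summable. -/
theorem setIntegral_mul_conj_axisKernel {α : ℝ} (hα : 0 < α) {f : ℂ × ℂ → ℂ}
    (hf : DifferentiableOn ℂ f (thullenDomain α)) (hI : IntegrableOn f (thullenDomain α)) {s : ℂ}
    (hs : ‖s‖ < 1) :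
    ∫ z in thullenDomain α, f z * (starRingEnd ℂ) (axisKernel α (z.1 * (starRingEnd ℂ) s)) =
      f (s, 0) := by
  have hm := (isOpen_thullenDomain hα).measurableSet
  set c : ℕ → ℝ := fun n => (n + 1) * (α * (n + 1) + 1) / Real.pi ^ 2 with hc
  have hc0 : ∀ n, 0 < c n := fun n => by positivity
  set F : ℕ → ℂ × ℂ → ℂ := fun n z => (c n * s ^ n) * ((starRingEnd ℂ) z.1 ^ n * f z) with hF
  have hgI : ∀ n, IntegrableOn (fun z : ℂ × ℂ => (starRingEnd ℂ) z.1 ^ n * f z)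
      (thullenDomain α) ∧
      ∫ z in thullenDomain α, ‖(starRingEnd ℂ) z.1 ^ n * f z‖ ≤ ∫ z in thullenDomain α, ‖f z‖ := by
    intro n
    have hb : ∀ z ∈ thullenDomain α, ‖(starRingEnd ℂ) z.1 ^ n‖ ≤ 1 := fun z hz => by
      rw [norm_pow, RCLike.norm_conj]
      exact pow_le_one₀ (norm_nonneg _) (norm_fst_lt_one_of_mem hα hz).le
    have h1 : IntegrableOn (fun z : ℂ × ℂ => (starRingEnd ℂ) z.1 ^ n * f z)
        (thullenDomain α) := by
      refine Integrable.bdd_mul hI (c := 1) ?_ ?_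
      · exact ((Complex.continuous_conj.comp continuous_fst).pow n).aestronglyMeasurable
      · exact (ae_restrict_iff' hm).mpr (Filter.Eventually.of_forall hb)
    refine ⟨h1, setIntegral_mono_on h1.norm hI.norm hm fun z hz => ?_⟩
    rw [norm_mul]
    exact mul_le_of_le_one_left (norm_nonneg _) (hb z hz)
  have hsum : HasSum (fun n => ∫ z in thullenDomain α, F n z)
      (∫ z in thullenDomain α, ∑' n, F n z) := by
    refine hasSum_integral_of_summable_integral_norm (fun n => (hgI n).1.const_mul _) ?_
    have hs' : Summable fun n => ‖((c n : ℝ) : ℂ) * s ^ n‖ * ∫ z in thullenDomain α, ‖f z‖ :=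
      ((hasSum_axisKernel α hs).summable.norm).mul_right _
    refine Summable.of_nonneg_of_le (fun n => integral_nonneg fun z => norm_nonneg _)
      (fun n => ?_) hs'
    simp only [hF, norm_mul _ (_ * f _)]
    rw [integral_const_mul]
    exact mul_le_mul_of_nonneg_left (hgI n).2 (norm_nonneg _)
  have htsum : ∀ z ∈ thullenDomain α, ∑' n, F n z =
      f z * (starRingEnd ℂ) (axisKernel α (z.1 * (starRingEnd ℂ) s)) := by
    intro z hz
    have hlt : ‖(starRingEnd ℂ) z.1 * s‖ < 1 := by
      rw [norm_mul, RCLike.norm_conj]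
      have := norm_fst_lt_one_of_mem hα hz
      nlinarith [norm_nonneg z.1, norm_nonneg s]
    rw [axisKernel_conj, map_mul, Complex.conj_conj]
    refine HasSum.tsum_eq ?_
    refine HasSum.of_forall_eq ((hasSum_axisKernel α hlt).mul_left (f z)) fun n => ?_
    simp only [hF, mul_pow, hc]
    ring
  rw [setIntegral_congr_fun hm htsum] at hsum
  have htaylor := Complex.hasSum_taylorSeries_on_ball (f := fun x => f (x, 0)) (c := 0) (r := 1)
    (hf.comp (f := fun x => (x, (0 : ℂ))) (by fun_prop)
      fun x hx => (mk_zero_mem_thullenDomain_iff hα).mpr hx) (z := s) (by simpa using hs)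
  refine hsum.unique ?_
  refine HasSum.of_forall_eq htaylor fun n => ?_
  simp only [hF]
  rw [integral_const_mul, setIntegral_thullenDomain_mul_conj_pow hα hf hI]
  have h1 : ((c n : ℝ) : ℂ) * (Real.pi ^ 2 / ((n + 1) * (α * (n + 1) + 1)) : ℝ) = 1 := by
    rw [← Complex.ofReal_mul, ← Complex.ofReal_one]
    congr 1
    have : 0 < α * (n + 1) + 1 := by positivity
    simp only [hc]
    field_simp
  simp only [sub_zero, smul_eq_mul]
  linear_combination (s ^ n * iteratedDeriv n (fun x => f (x, 0)) 0 / n.factorial) * h1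

/-! ### Powers and the unit disc -/

theorem ofReal_mul_cpow {r : ℝ} (hr : 0 < r) {v : ℂ} (hv : v ≠ 0) (c : ℝ) :
    ((r : ℂ) * v) ^ (c : ℂ) = ((r ^ c : ℝ) : ℂ) * v ^ (c : ℂ) := by
  have hr' : (r : ℂ) ≠ 0 := by exact_mod_cast hr.ne'
  rw [Complex.ofReal_cpow hr.le, Complex.cpow_def_of_ne_zero (mul_ne_zero hr' hv),
    Complex.cpow_def_of_ne_zero hr', Complex.cpow_def_of_ne_zero hv, ← Complex.exp_add,
    Complex.log_ofReal_mul hr hv, Complex.ofReal_log hr.le]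
  ring_nf

theorem ofReal_div_cpow {r : ℝ} (hr : 0 < r) {v : ℂ} (hv : 0 < v.re) (c : ℝ) :
    ((r : ℂ) / v) ^ (c : ℂ) = ((r ^ c : ℝ) : ℂ) * (v ^ (c : ℂ))⁻¹ := by
  have hv0 : v ≠ 0 := fun h => by simp [h] at hv
  rw [div_eq_mul_inv, ofReal_mul_cpow hr (inv_ne_zero hv0), Complex.inv_cpow]
  exact (Complex.mem_slitPlane_iff_arg.mp (Or.inl hv)).1

theorem norm_one_sub_mul_conj_sq (x y : ℂ) :
    ‖1 - x * (starRingEnd ℂ) y‖ ^ 2 = ‖x - y‖ ^ 2 + (1 - ‖x‖ ^ 2) * (1 - ‖y‖ ^ 2) := by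
  simp only [Complex.sq_norm, Complex.normSq_apply, Complex.sub_re, Complex.sub_im,
    Complex.mul_re, Complex.mul_im, Complex.one_re, Complex.one_im, Complex.conj_re,
    Complex.conj_im]
  ring

theorem one_sub_mul_conj_re_pos {x y : ℂ} (hx : ‖x‖ < 1) (hy : ‖y‖ < 1) :
    0 < (1 - x * (starRingEnd ℂ) y).re := by
  have h1 := Complex.re_le_norm (x * (starRingEnd ℂ) y)
  rw [norm_mul, RCLike.norm_conj] at h1
  rw [Complex.sub_re, Complex.one_re]
  nlinarith [norm_nonneg x, norm_nonneg y]

theorem one_sub_mul_conj_ne_zero {x y : ℂ} (hx : ‖x‖ < 1) (hy : ‖y‖ < 1) :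
    1 - x * (starRingEnd ℂ) y ≠ 0 := fun h => by
  have := one_sub_mul_conj_re_pos hx hy
  simp [h] at this

theorem one_sub_norm_sq_pos {x : ℂ} (hx : ‖x‖ < 1) : 0 < 1 - ‖x‖ ^ 2 := by
  nlinarith [norm_nonneg x]

/-! ### The Bergman kernel of the Thullen domain -/

/-- The ratio `|z₁|² / (1 - |z₂|²)^α`, which is smaller than `1` on the Thullen domain. -/
noncomputable def thullenRatio (α : ℝ) (z : ℂ × ℂ) : ℝ := ‖z.1‖ ^ 2 * (1 - ‖z.2‖ ^ 2) ^ (-α)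

/-- The sesquiholomorphic extension of `thullenRatio`. -/
noncomputable def thullenCross (α : ℝ) (z w : ℂ × ℂ) : ℂ :=
  z.1 * (starRingEnd ℂ) w.1 * (1 - z.2 * (starRingEnd ℂ) w.2) ^ ((-α : ℝ) : ℂ)

/-- The Bergman kernel of the Thullen domain in closed form. -/
noncomputable def thullenKernel (α : ℝ) (z w : ℂ × ℂ) : ℂ :=
  (1 - z.2 * (starRingEnd ℂ) w.2) ^ ((-(2 + α) : ℝ) : ℂ) * axisKernel α (thullenCross α z w)

theorem mem_thullenDomain_iff_sq_lt {α : ℝ} (hα : 0 < α) {z : ℂ × ℂ} :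
    z ∈ thullenDomain α ↔ ‖z.2‖ < 1 ∧ ‖z.1‖ ^ 2 < (1 - ‖z.2‖ ^ 2) ^ α := by
  have key : ‖z.2‖ < 1 → (‖z.1‖ ^ (2 / α) + ‖z.2‖ ^ 2 < 1 ↔ ‖z.1‖ ^ 2 < (1 - ‖z.2‖ ^ 2) ^ α) := by
    intro h
    have h1 : ‖z.1‖ ^ 2 = (‖z.1‖ ^ (2 / α)) ^ α := by
      rw [← Real.rpow_mul (norm_nonneg _), div_mul_cancel₀ _ hα.ne']
      norm_cast
    rw [h1, Real.rpow_lt_rpow_iff (Real.rpow_nonneg (norm_nonneg _) _) (one_sub_norm_sq_pos h).le hα]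
    constructor <;> intro h <;> linarith
  exact ⟨fun h => ⟨norm_snd_lt_one_of_mem h, (key (norm_snd_lt_one_of_mem h)).mp h⟩,
    fun h => (key h.1).mpr h.2⟩

theorem mem_thullenDomain_iff {α : ℝ} (hα : 0 < α) {z : ℂ × ℂ} :
    z ∈ thullenDomain α ↔ ‖z.2‖ < 1 ∧ thullenRatio α z < 1 := by
  rw [mem_thullenDomain_iff_sq_lt hα]
  refine and_congr_right fun h => ?_
  have := Real.rpow_pos_of_pos (one_sub_norm_sq_pos h) α
  rw [thullenRatio, Real.rpow_neg (one_sub_norm_sq_pos h).le, ← div_eq_mul_inv, div_lt_one this]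

theorem thullenRatio_nonneg {α : ℝ} {z : ℂ × ℂ} (hz : ‖z.2‖ < 1) : 0 ≤ thullenRatio α z :=
  mul_nonneg (sq_nonneg _) (Real.rpow_nonneg (one_sub_norm_sq_pos hz).le _)

/-- A Cauchy–Schwarz inequality: drop |x - y|² in `norm_one_sub_mul_conj_sq` and use that the
exponent -α is negative. It bounds the argument of `axisKernel` away from 1 uniformly in z, so that
kernel functions are bounded. -/
theorem norm_thullenCross_sq_le {α : ℝ} (hα : 0 < α) {z w : ℂ × ℂ} (hz : ‖z.2‖ < 1)
    (hw : ‖w.2‖ < 1) : ‖thullenCross α z w‖ ^ 2 ≤ thullenRatio α z * thullenRatio α w := by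
  have hz' := one_sub_norm_sq_pos hz
  have hw' := one_sub_norm_sq_pos hw
  have hu := norm_pos_iff.mpr (one_sub_mul_conj_ne_zero hz hw)
  have h1 : (‖1 - z.2 * (starRingEnd ℂ) w.2‖ ^ (-α)) ^ 2 ≤
      (1 - ‖z.2‖ ^ 2) ^ (-α) * (1 - ‖w.2‖ ^ 2) ^ (-α) := by
    rw [← Real.mul_rpow hz'.le hw'.le, ← Real.rpow_natCast, ← Real.rpow_mul hu.le,
      mul_comm (-α), Real.rpow_mul hu.le, Real.rpow_natCast, norm_one_sub_mul_conj_sq]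
    exact Real.rpow_le_rpow_of_nonpos (by positivity)
      (le_add_of_nonneg_left (sq_nonneg _)) (by linarith)
  rw [thullenCross, norm_mul, norm_mul, RCLike.norm_conj, Complex.norm_cpow_real, mul_pow, mul_pow,
    thullenRatio, thullenRatio]
  calc ‖z.1‖ ^ 2 * ‖w.1‖ ^ 2 * (‖1 - z.2 * (starRingEnd ℂ) w.2‖ ^ (-α)) ^ 2
      ≤ ‖z.1‖ ^ 2 * ‖w.1‖ ^ 2 * ((1 - ‖z.2‖ ^ 2) ^ (-α) * (1 - ‖w.2‖ ^ 2) ^ (-α)) := by gcongr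
    _ = _ := by ring

theorem norm_thullenCross_le_sqrt {α : ℝ} (hα : 0 < α) {z w : ℂ × ℂ} (hz : z ∈ thullenDomain α)
    (hw : w ∈ thullenDomain α) : ‖thullenCross α z w‖ ≤ √(thullenRatio α w) := by
  have hz' := (mem_thullenDomain_iff hα).mp hz
  have hw' := (mem_thullenDomain_iff hα).mp hw
  refine Real.le_sqrt_of_sq_le ((norm_thullenCross_sq_le hα hz'.1 hw'.1).trans ?_)
  exact mul_le_of_le_one_left (thullenRatio_nonneg hw'.1) hz'.2.le

theorem sqrt_thullenRatio_lt_one {α : ℝ} (hα : 0 < α) {w : ℂ × ℂ} (hw : w ∈ thullenDomain α) :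
    √(thullenRatio α w) < 1 := by
  rw [Real.sqrt_lt' one_pos, one_pow]
  exact ((mem_thullenDomain_iff hα).mp hw).2

theorem norm_thullenCross_lt_one {α : ℝ} (hα : 0 < α) {z w : ℂ × ℂ} (hz : z ∈ thullenDomain α)
    (hw : w ∈ thullenDomain α) : ‖thullenCross α z w‖ < 1 :=
  (norm_thullenCross_le_sqrt hα hz hw).trans_lt (sqrt_thullenRatio_lt_one hα hw)

theorem differentiableOn_one_sub_cpow {α : ℝ} {w : ℂ × ℂ} (hw : ‖w.2‖ < 1) (c : ℂ) :
    DifferentiableOn ℂ (fun z : ℂ × ℂ => (1 - z.2 * (starRingEnd ℂ) w.2) ^ c)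
      (thullenDomain α) := fun z hz =>
  DifferentiableAt.differentiableWithinAt <|
    DifferentiableAt.cpow (by fun_prop) (by fun_prop)
      (Or.inl (one_sub_mul_conj_re_pos (norm_snd_lt_one_of_mem hz) hw))

theorem one_sub_ne_zero_of_norm_lt_one {y : ℂ} (hy : ‖y‖ < 1) : 1 - y ≠ 0 :=
  sub_ne_zero.mpr fun h => by simp [← h] at hy

theorem differentiableOn_thullenKernel {α : ℝ} (hα : 0 < α) {w : ℂ × ℂ}
    (hw : w ∈ thullenDomain α) :
    DifferentiableOn ℂ (fun z => thullenKernel α z w) (thullenDomain α) := by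
  have hw2 := norm_snd_lt_one_of_mem hw
  have hX : DifferentiableOn ℂ (fun z => thullenCross α z w) (thullenDomain α) :=
    DifferentiableOn.mul (by fun_prop) (differentiableOn_one_sub_cpow hw2 _)
  simp only [thullenKernel, axisKernel, div_eq_mul_inv]
  refine (differentiableOn_one_sub_cpow hw2 _).mul
    (DifferentiableOn.mul ?_ (DifferentiableOn.fun_inv ?_ fun z hz => ?_))
  · exact (hX.const_mul _).const_add _
  · exact ((hX.const_sub _).pow 3).const_mul _
  · have := one_sub_ne_zero_of_norm_lt_one (norm_thullenCross_lt_one hα hz hw)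
    have hpi : (Real.pi : ℂ) ≠ 0 := by exact_mod_cast Real.pi_ne_zero
    positivity

theorem memBergmanSpace_thullenKernel {α : ℝ} (hα : 0 < α) {w : ℂ × ℂ}
    (hw : w ∈ thullenDomain α) :
    MemBergmanSpace (thullenDomain α) (fun z => thullenKernel α z w) := by
  have hw2 := norm_snd_lt_one_of_mem hw
  set ρ := √(thullenRatio α w) with hρ
  have hρ1 : ρ < 1 := sqrt_thullenRatio_lt_one hα hw
  refine memBergmanSpace_of_bounded (isOpen_thullenDomain hα).measurableSet
    (isBounded_thullenDomain hα).measure_lt_top.ne (differentiableOn_thullenKernel hα hw)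
    ((1 - ‖w.2‖) ^ (-(2 + α)) * (((α + 1) + (α + 1)) / (Real.pi ^ 2 * (1 - ρ) ^ 3)))
    fun z hz => ?_
  have hX := norm_thullenCross_le_sqrt hα hz hw
  have hz2 := norm_snd_lt_one_of_mem hz
  have h1 : 1 - ‖w.2‖ ≤ ‖1 - z.2 * (starRingEnd ℂ) w.2‖ := by
    have h := norm_sub_norm_le 1 (z.2 * (starRingEnd ℂ) w.2)
    rw [norm_one, norm_mul, RCLike.norm_conj] at h
    nlinarith [norm_nonneg w.2]
  have h2 : 1 - ρ ≤ ‖1 - thullenCross α z w‖ := by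
    have h := norm_sub_norm_le 1 (thullenCross α z w)
    rw [norm_one] at h
    linarith
  rw [thullenKernel, norm_mul, Complex.norm_cpow_real, axisKernel, norm_div, norm_mul, norm_pow,
    norm_pow, Complex.norm_real, Real.norm_of_nonneg Real.pi_pos.le]
  have h3 : 0 < 1 - ρ := by linarith
  have h4 : ‖(α : ℂ) + 1 + (α - 1) * thullenCross α z w‖ ≤ (α + 1) + (α + 1) := by
    have e1 : ‖(α : ℂ) + 1‖ = α + 1 := by
      rw [show (α : ℂ) + 1 = ((α + 1 : ℝ) : ℂ) by push_cast; rfl, Complex.norm_real,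
        Real.norm_of_nonneg (by linarith)]
    have e2 : ‖(α : ℂ) - 1‖ ≤ α + 1 := by
      rw [show (α : ℂ) - 1 = ((α - 1 : ℝ) : ℂ) by push_cast; rfl, Complex.norm_real,
        Real.norm_eq_abs, abs_le]
      constructor <;> linarith
    refine (norm_add_le _ _).trans ?_
    rw [e1, norm_mul]
    have : ‖thullenCross α z w‖ ≤ 1 := by linarith
    nlinarith [norm_nonneg ((α : ℂ) - 1), norm_nonneg (thullenCross α z w)]
  have h5 : ‖1 - z.2 * (starRingEnd ℂ) w.2‖ ^ (-(2 + α)) ≤ (1 - ‖w.2‖) ^ (-(2 + α)) :=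
    Real.rpow_le_rpow_of_nonpos (by linarith) h1 (by linarith)
  have h6 : (0 : ℝ) ≤ (1 - ‖w.2‖) ^ (-(2 + α)) := Real.rpow_nonneg (by linarith) _
  have := Real.pi_pos
  gcongr

/-! ### Automorphisms of the Thullen domain -/

/-- The automorphism of the Thullen domain that sends `(x, 0)` to `((1 - |a|²)^(α/2) x, a)`. -/
noncomputable def thullenAut (α : ℝ) (a : ℂ) (z : ℂ × ℂ) : ℂ × ℂ :=
  (z.1 * (((1 - ‖a‖ ^ 2) ^ (α / 2) : ℝ) * (1 - z.2 * (starRingEnd ℂ) (-a)) ^ ((-α : ℝ) : ℂ)),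
    (z.2 + a) / (1 - z.2 * (starRingEnd ℂ) (-a)))

/-- The complex Jacobian determinant of `thullenAut`. -/
noncomputable def thullenAutJac (α : ℝ) (a : ℂ) (z : ℂ × ℂ) : ℂ :=
  ((1 - ‖a‖ ^ 2) ^ (α / 2) : ℝ) * (1 - z.2 * (starRingEnd ℂ) (-a)) ^ ((-α : ℝ) : ℂ) *
    ((1 - ‖a‖ ^ 2 : ℝ) / (1 - z.2 * (starRingEnd ℂ) (-a)) ^ 2)

theorem ofReal_one_sub_norm_sq (a : ℂ) :
    ((1 - ‖a‖ ^ 2 : ℝ) : ℂ) = 1 - a * (starRingEnd ℂ) a := by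
  rw [Complex.mul_conj, Complex.normSq_eq_norm_sq]
  push_cast
  rfl

/-- The second component of `thullenAut` depends on z₂ alone, so its complex derivative is
triangular; the real determinant is the squared modulus of the complex one. -/
theorem det_restrictScalars_toLin (m b c : ℂ) :
    ((Matrix.toLin (.finTwoProd ℂ) (.finTwoProd ℂ)
      !![m, b; 0, c]).toContinuousLinearMap.restrictScalars ℝ).det = ‖m * c‖ ^ 2 := by
  rw [ContinuousLinearMap.det]
  have : (((Matrix.toLin (.finTwoProd ℂ) (.finTwoProd ℂ)
      !![m, b; 0, c]).toContinuousLinearMap.restrictScalars ℝ : (ℂ × ℂ) →L[ℝ] ℂ × ℂ) :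
        (ℂ × ℂ) →ₗ[ℝ] ℂ × ℂ) = (Matrix.toLin (.finTwoProd ℂ) (.finTwoProd ℂ)
      !![m, b; 0, c]).restrictScalars ℝ := rfl
  rw [this, LinearMap.det_restrictScalars, LinearMap.det_toLin, Algebra.norm_complex_eq,
    Matrix.det_fin_two_of, mul_zero, sub_zero, ← Complex.normSq_eq_norm_sq]
  rfl

theorem exists_hasFDerivAt_thullenAut (α : ℝ) {a : ℂ} (ha : ‖a‖ < 1) {z : ℂ × ℂ}
    (hz : ‖z.2‖ < 1) :
    ∃ L : (ℂ × ℂ) →L[ℂ] ℂ × ℂ, HasFDerivAt (thullenAut α a) L z ∧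
      (L.restrictScalars ℝ).det = ‖thullenAutJac α a z‖ ^ 2 := by
  have ha' : ‖-a‖ < 1 := by rwa [norm_neg]
  have hre := one_sub_mul_conj_re_pos hz ha'
  have hne := one_sub_mul_conj_ne_zero hz ha'
  set l : ℂ := (((1 - ‖a‖ ^ 2) ^ (α / 2) : ℝ) : ℂ) with hl
  have hlin : HasDerivAt (fun y : ℂ => 1 - y * (starRingEnd ℂ) (-a)) (-(starRingEnd ℂ) (-a)) z.2 := by
    simpa using ((hasDerivAt_id z.2).mul_const ((starRingEnd ℂ) (-a))).const_sub 1
  obtain ⟨m', hm⟩ : ∃ m', HasDerivAt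
      (fun y : ℂ => l * (1 - y * (starRingEnd ℂ) (-a)) ^ ((-α : ℝ) : ℂ)) m' z.2 :=
    ⟨_, (hlin.cpow_const (Or.inl hre)).const_mul l⟩
  have hφ : HasDerivAt (fun y : ℂ => (y + a) / (1 - y * (starRingEnd ℂ) (-a)))
      ((1 - ‖a‖ ^ 2 : ℝ) / (1 - z.2 * (starRingEnd ℂ) (-a)) ^ 2) z.2 := by
    refine (((hasDerivAt_id z.2).add_const a).div hlin hne).congr_deriv ?_
    rw [ofReal_one_sub_norm_sq]
    simp only [map_neg, id_eq]
    ring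
  refine ⟨_, ?_, det_restrictScalars_toLin
    (l * (1 - z.2 * (starRingEnd ℂ) (-a)) ^ ((-α : ℝ) : ℂ)) (z.1 * m')
    ((1 - ‖a‖ ^ 2 : ℝ) / (1 - z.2 * (starRingEnd ℂ) (-a)) ^ 2)⟩
  rw [Matrix.toLin_finTwoProd_toContinuousLinearMap]
  have h1 := (hasFDerivAt_fst (𝕜 := ℂ) (p := z)).mul
    (hm.comp_hasFDerivAt z (hasFDerivAt_snd (𝕜 := ℂ) (p := z)))
  have h2 := hφ.comp_hasFDerivAt z (hasFDerivAt_snd (𝕜 := ℂ) (p := z))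
  refine (HasFDerivAt.prodMk h1 h2).congr_fderiv ?_
  ext <;> simp

theorem one_sub_norm_snd_thullenAut_sq (α : ℝ) {a : ℂ} (ha : ‖a‖ < 1) {z : ℂ × ℂ}
    (hz : ‖z.2‖ < 1) :
    1 - ‖(thullenAut α a z).2‖ ^ 2 =
      (1 - ‖a‖ ^ 2) * (1 - ‖z.2‖ ^ 2) / ‖1 - z.2 * (starRingEnd ℂ) (-a)‖ ^ 2 := by
  have ha' : ‖-a‖ < 1 := by rwa [norm_neg]
  have hne := norm_ne_zero_iff.mpr (one_sub_mul_conj_ne_zero hz ha')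
  have h := norm_one_sub_mul_conj_sq z.2 (-a)
  rw [norm_neg, sub_neg_eq_add] at h
  simp only [thullenAut]
  rw [norm_div, div_pow, eq_div_iff (by positivity), sub_mul, div_mul_cancel₀ _ (by positivity)]
  linarith

theorem norm_snd_thullenAut_lt_one (α : ℝ) {a : ℂ} (ha : ‖a‖ < 1) {z : ℂ × ℂ}
    (hz : ‖z.2‖ < 1) : ‖(thullenAut α a z).2‖ < 1 := by
  have ha' : ‖-a‖ < 1 := by rwa [norm_neg]
  have h := one_sub_norm_snd_thullenAut_sq α ha hz
  have h1 : 0 < 1 - ‖(thullenAut α a z).2‖ ^ 2 := by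
    rw [h]
    have := norm_pos_iff.mpr (one_sub_mul_conj_ne_zero hz ha')
    have := one_sub_norm_sq_pos hz
    have := one_sub_norm_sq_pos ha
    positivity
  nlinarith [norm_nonneg (thullenAut α a z).2]

/-- The ratio is invariant, and together with |z₂| < 1 it determines the domain. Hence the maps
preserve it. -/
theorem thullenRatio_thullenAut (α : ℝ) {a : ℂ} (ha : ‖a‖ < 1) {z : ℂ × ℂ}
    (hz : ‖z.2‖ < 1) : thullenRatio α (thullenAut α a z) = thullenRatio α z := by
  have ha' : ‖-a‖ < 1 := by rwa [norm_neg]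
  have hu := norm_pos_iff.mpr (one_sub_mul_conj_ne_zero hz ha')
  have h1 := one_sub_norm_sq_pos hz
  have h2 := one_sub_norm_sq_pos ha
  rw [thullenRatio, one_sub_norm_snd_thullenAut_sq α ha hz, thullenRatio,
    Real.div_rpow (by positivity) (by positivity), Real.mul_rpow h2.le h1.le]
  have e1 : (‖1 - z.2 * (starRingEnd ℂ) (-a)‖ ^ 2) ^ (-α) =
      (‖1 - z.2 * (starRingEnd ℂ) (-a)‖ ^ (-α)) ^ 2 := by
    rw [← Real.rpow_natCast, ← Real.rpow_natCast, ← Real.rpow_mul hu.le, ← Real.rpow_mul hu.le,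
      mul_comm (-α)]
  have e2 : ((1 - ‖a‖ ^ 2) ^ (α / 2)) ^ 2 * (1 - ‖a‖ ^ 2) ^ (-α) = 1 := by
    rw [← Real.rpow_natCast, ← Real.rpow_mul h2.le, ← Real.rpow_add h2]
    simp
  have e3 := Real.rpow_pos_of_pos hu (-α)
  simp only [thullenAut]
  rw [norm_mul, norm_mul, Complex.norm_real, Complex.norm_cpow_real,
    Real.norm_of_nonneg (Real.rpow_nonneg h2.le _), e1]
  field_simp
  linear_combination (‖z.1‖ ^ 2) * e2

theorem thullenAut_mem_iff {α : ℝ} (hα : 0 < α) {a : ℂ} (ha : ‖a‖ < 1) {z : ℂ × ℂ}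
    (hz : ‖z.2‖ < 1) : thullenAut α a z ∈ thullenDomain α ↔ z ∈ thullenDomain α := by
  rw [mem_thullenDomain_iff hα, mem_thullenDomain_iff hα, thullenRatio_thullenAut α ha hz]
  simp [norm_snd_thullenAut_lt_one α ha hz, hz]

theorem thullenAut_factor_ne_zero (α : ℝ) {a y : ℂ} (ha : ‖a‖ < 1) (hy : ‖y‖ < 1) :
    (((1 - ‖a‖ ^ 2) ^ (α / 2) : ℝ) : ℂ) * (1 - y * (starRingEnd ℂ) (-a)) ^ ((-α : ℝ) : ℂ) ≠ 0 := by
  have ha' : ‖-a‖ < 1 := by rwa [norm_neg]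
  have h := (Real.rpow_pos_of_pos (one_sub_norm_sq_pos ha) (α / 2)).ne'
  refine mul_ne_zero (by exact_mod_cast h) ?_
  rw [← norm_ne_zero_iff, Complex.norm_cpow_real]
  exact (Real.rpow_pos_of_pos (norm_pos_iff.mpr (one_sub_mul_conj_ne_zero hy ha')) _).ne'

theorem injOn_thullenAut (α : ℝ) {a : ℂ} (ha : ‖a‖ < 1) :
    Set.InjOn (thullenAut α a) (thullenDomain α) := by
  intro z hz w hw h
  have ha' : ‖-a‖ < 1 := by rwa [norm_neg]
  have hz2 := norm_snd_lt_one_of_mem hz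
  have hw2 := norm_snd_lt_one_of_mem hw
  have h1 : (z.2 + a) / (1 - z.2 * (starRingEnd ℂ) (-a)) =
      (w.2 + a) / (1 - w.2 * (starRingEnd ℂ) (-a)) := congrArg Prod.snd h
  have e2 : z.2 = w.2 := by
    rw [div_eq_div_iff (one_sub_mul_conj_ne_zero hz2 ha') (one_sub_mul_conj_ne_zero hw2 ha')] at h1
    have hl : (1 : ℂ) - a * (starRingEnd ℂ) a ≠ 0 := one_sub_mul_conj_ne_zero ha ha
    refine mul_left_cancel₀ hl ?_
    simp only [map_neg] at h1
    linear_combination h1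
  have h3 := congrArg Prod.fst h
  simp only [thullenAut, e2] at h3
  exact Prod.ext (mul_right_cancel₀ (thullenAut_factor_ne_zero α ha hw2) h3) e2

theorem image_thullenAut {α : ℝ} (hα : 0 < α) {a : ℂ} (ha : ‖a‖ < 1) :
    thullenAut α a '' thullenDomain α = thullenDomain α := by
  refine Set.Subset.antisymm ?_ fun z hz => ?_
  · rintro _ ⟨z, hz, rfl⟩
    exact (thullenAut_mem_iff hα ha (norm_snd_lt_one_of_mem hz)).mpr hz
  · have hz2 := norm_snd_lt_one_of_mem hz
    have hne := one_sub_mul_conj_ne_zero hz2 ha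
    have hl : (1 : ℂ) - a * (starRingEnd ℂ) a ≠ 0 := one_sub_mul_conj_ne_zero ha ha
    set y := (z.2 - a) / (1 - z.2 * (starRingEnd ℂ) a) with hy
    have hy1 : ‖y‖ < 1 := by
      have h := norm_snd_thullenAut_lt_one α (a := -a) (by rwa [norm_neg]) hz2
      simpa only [thullenAut, neg_neg, ← sub_eq_add_neg] using h
    have hd : 1 - y * (starRingEnd ℂ) (-a) =
        (1 - a * (starRingEnd ℂ) a) / (1 - z.2 * (starRingEnd ℂ) a) := by
      rw [hy, map_neg]
      field_simp
      ring
    have hval : thullenAut α a (z.1 / ((((1 - ‖a‖ ^ 2) ^ (α / 2) : ℝ) : ℂ) *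
        (1 - y * (starRingEnd ℂ) (-a)) ^ ((-α : ℝ) : ℂ)), y) = z := by
      refine Prod.ext ?_ ?_
      · exact div_mul_cancel₀ _ (thullenAut_factor_ne_zero α ha hy1)
      · simp only [thullenAut]
        rw [hd, hy]
        field_simp
        ring
    refine ⟨_, ?_, hval⟩
    rw [← thullenAut_mem_iff hα ha hy1, hval]
    exact hz

theorem one_sub_snd_thullenAut_mul_conj (α : ℝ) {a : ℂ} (ha : ‖a‖ < 1) {z : ℂ × ℂ}
    (hz : ‖z.2‖ < 1) :
    1 - (thullenAut α a z).2 * (starRingEnd ℂ) a =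
      ((1 - ‖a‖ ^ 2 : ℝ) : ℂ) / (1 - z.2 * (starRingEnd ℂ) (-a)) := by
  have hne := one_sub_mul_conj_ne_zero hz (show ‖-a‖ < 1 by rwa [norm_neg])
  rw [ofReal_one_sub_norm_sq, eq_div_iff hne, thullenAut, sub_mul, div_mul_eq_mul_div,
    div_mul_cancel₀ _ hne, map_neg]
  ring

theorem thullenCross_thullenAut (α : ℝ) {w z : ℂ × ℂ} (hw : ‖w.2‖ < 1) (hz : ‖z.2‖ < 1) :
    thullenCross α (thullenAut α w.2 z) w =
      z.1 * (starRingEnd ℂ) (w.1 * ((1 - ‖w.2‖ ^ 2) ^ (-(α / 2)) : ℝ)) := by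
  have hw' : ‖-w.2‖ < 1 := by rwa [norm_neg]
  have hl := one_sub_norm_sq_pos hw
  have hq : (1 - z.2 * (starRingEnd ℂ) (-w.2)) ^ ((-α : ℝ) : ℂ) ≠ 0 :=
    right_ne_zero_of_mul (thullenAut_factor_ne_zero α hw hz)
  rw [thullenCross, one_sub_snd_thullenAut_mul_conj α hw hz,
    ofReal_div_cpow hl (one_sub_mul_conj_re_pos hz hw')]
  have e : ((1 - ‖w.2‖ ^ 2) ^ (-(α / 2)) : ℝ) =
      (1 - ‖w.2‖ ^ 2) ^ (α / 2) * (1 - ‖w.2‖ ^ 2) ^ (-α) := by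
    rw [← Real.rpow_add hl]
    ring_nf
  rw [e, map_mul, Complex.conj_ofReal, thullenAut]
  push_cast at hq ⊢
  field_simp

/-- The transformation rule of Bergman kernels under the automorphism taking (s, 0) to w. The power
on the right is the inverse of its Jacobian at (s, 0), which is real. -/
theorem thullenKernel_thullenAut_mul_jac (α : ℝ) {w z : ℂ × ℂ} (hw : ‖w.2‖ < 1)
    (hz : ‖z.2‖ < 1) :
    thullenKernel α (thullenAut α w.2 z) w * thullenAutJac α w.2 z =
      ((1 - ‖w.2‖ ^ 2) ^ (-1 - α / 2) : ℝ) *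
        axisKernel α (z.1 * (starRingEnd ℂ) (w.1 * ((1 - ‖w.2‖ ^ 2) ^ (-(α / 2)) : ℝ))) := by
  have hw' : ‖-w.2‖ < 1 := by rwa [norm_neg]
  have hl := one_sub_norm_sq_pos hw
  have hv := one_sub_mul_conj_ne_zero hz hw'
  have hq : (1 - z.2 * (starRingEnd ℂ) (-w.2)) ^ ((-α : ℝ) : ℂ) ≠ 0 :=
    right_ne_zero_of_mul (thullenAut_factor_ne_zero α hw hz)
  rw [thullenKernel, thullenCross_thullenAut α hw hz, one_sub_snd_thullenAut_mul_conj α hw hz,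
    ofReal_div_cpow hl (one_sub_mul_conj_re_pos hz hw'), thullenAutJac]
  have e1 : (1 - z.2 * (starRingEnd ℂ) (-w.2)) ^ ((-(2 + α) : ℝ) : ℂ) =
      (1 - z.2 * (starRingEnd ℂ) (-w.2)) ^ ((-α : ℝ) : ℂ) /
        (1 - z.2 * (starRingEnd ℂ) (-w.2)) ^ 2 := by
    rw [← Complex.cpow_ofNat, ← Complex.cpow_sub _ _ hv]
    congr 1
    push_cast
    ring
  have e2 : (((1 - ‖w.2‖ ^ 2) ^ (-1 - α / 2) : ℝ) : ℂ) = ((1 - ‖w.2‖ ^ 2) ^ (-(2 + α)) : ℝ) *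
      ((1 - ‖w.2‖ ^ 2) ^ (α / 2) : ℝ) * ((1 - ‖w.2‖ ^ 2 : ℝ) : ℂ) := by
    rw [← Complex.ofReal_mul, ← Complex.ofReal_mul, ← Real.rpow_add hl]
    nth_rewrite 3 [← Real.rpow_one (1 - ‖w.2‖ ^ 2)]
    rw [← Real.rpow_add hl]
    congr 2
    ring
  rw [e1, e2]
  field_simp

theorem differentiableOn_thullenAutJac (α : ℝ) {a : ℂ} (ha : ‖a‖ < 1) :
    DifferentiableOn ℂ (thullenAutJac α a) (thullenDomain α) := by
  have ha' : ‖((0 : ℂ), -a).2‖ < 1 := by rwa [norm_neg]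
  have h := differentiableOn_one_sub_cpow (α := α) ha' ((-α : ℝ) : ℂ)
  unfold thullenAutJac
  simp only [div_eq_mul_inv]
  refine (h.const_mul _).mul
    (DifferentiableOn.const_mul (DifferentiableOn.fun_inv (by fun_prop) fun z hz => ?_) _)
  exact pow_ne_zero 2 (one_sub_mul_conj_ne_zero (norm_snd_lt_one_of_mem hz) ha')

/-- Pulling f back to F = (f ∘ φ) · Jac φ keeps it in the Bergman space, where φ is the automorphism
with φ(s, 0) = w. The change of variables reduces the claim to the axis formula for F at (s, 0). -/
theorem isBergmanKernel_thullenKernel {α : ℝ} (hα : 0 < α) :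
    IsBergmanKernel (thullenDomain α) (thullenKernel α) := by
  intro w hw
  refine ⟨memBergmanSpace_thullenKernel hα hw, fun f hf => ?_⟩
  have hw2 := norm_snd_lt_one_of_mem hw
  have hl := one_sub_norm_sq_pos hw2
  have hm := (isOpen_thullenDomain hα).measurableSet
  have : IsFiniteMeasure (volume.restrict (thullenDomain α)) :=
    ⟨by simpa using (isBounded_thullenDomain hα).measure_lt_top⟩
  have hfI : IntegrableOn f (thullenDomain α) := hf.2.integrable (by norm_num)
  have : (volume : Measure (ℂ × ℂ)).IsAddHaarMeasure := Measure.prod.instIsAddHaarMeasure _ _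
  choose! L hL hdet using fun z (hz : z ∈ thullenDomain α) =>
    exists_hasFDerivAt_thullenAut α hw2 (norm_snd_lt_one_of_mem hz)
  have hL' : ∀ z ∈ thullenDomain α, HasFDerivWithinAt (thullenAut α w.2)
      ((L z).restrictScalars ℝ) (thullenDomain α) z := fun z hz =>
    ((hL z hz).restrictScalars ℝ).hasFDerivWithinAt
  have hinj := injOn_thullenAut α hw2
  have himg := image_thullenAut hα hw2
  have hmaps : Set.MapsTo (thullenAut α w.2) (thullenDomain α) (thullenDomain α) := fun z hz =>
    (thullenAut_mem_iff hα hw2 (norm_snd_lt_one_of_mem hz)).mpr hz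
  set F : ℂ × ℂ → ℂ := fun z => f (thullenAut α w.2 z) * thullenAutJac α w.2 z with hF
  have hFd : DifferentiableOn ℂ F (thullenDomain α) :=
    (hf.1.comp (fun z hz => (hL z hz).differentiableAt.differentiableWithinAt) hmaps).mul
      (differentiableOn_thullenAutJac α hw2)
  have hFL : MemLp F 2 (volume.restrict (thullenDomain α)) := by
    rw [memLp_two_iff_integrable_sq_norm (hFd.continuousOn.aestronglyMeasurable hm)]
    have h := hf.2.integrable_norm_pow (by norm_num)
    rw [← himg] at h
    have h2 := (integrableOn_image_iff_integrableOn_abs_det_fderiv_smul volume hm hL' hinj _).mp h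
    refine h2.congr_fun (fun z hz => ?_) hm
    simp only [hF, hdet z hz, norm_mul, smul_eq_mul]
    rw [abs_of_nonneg (by positivity), mul_pow, mul_comm]
  have hFI : IntegrableOn F (thullenDomain α) := hFL.integrable (by norm_num)
  set s : ℂ := w.1 * ((1 - ‖w.2‖ ^ 2) ^ (-(α / 2)) : ℝ) with hs
  have hs1 : ‖s‖ < 1 := by
    have h := ((mem_thullenDomain_iff hα).mp hw).2
    rw [thullenRatio] at h
    rw [hs, norm_mul, Complex.norm_real, Real.norm_of_nonneg (Real.rpow_nonneg hl.le _)]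
    refine lt_of_pow_lt_pow_left₀ 2 zero_le_one ?_
    rw [mul_pow, ← Real.rpow_natCast (_ ^ _), ← Real.rpow_mul hl.le, one_pow,
      show -(α / 2) * ((2 : ℕ) : ℝ) = -α by push_cast; ring]
    exact h
  have hbase := setIntegral_mul_conj_axisKernel hα hFd hFI hs1
  have hchange := integral_image_eq_integral_abs_det_fderiv_smul volume hm hL' hinj
    (fun z => f z * (starRingEnd ℂ) (thullenKernel α z w))
  rw [himg] at hchange
  rw [hchange]
  have hpt : ∀ z ∈ thullenDomain α, |((L z).restrictScalars ℝ).det| •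
      (f (thullenAut α w.2 z) * (starRingEnd ℂ) (thullenKernel α (thullenAut α w.2 z) w)) =
      ((1 - ‖w.2‖ ^ 2) ^ (-1 - α / 2) : ℝ) *
        (F z * (starRingEnd ℂ) (axisKernel α (z.1 * (starRingEnd ℂ) s))) := by
    intro z hz
    have h := congrArg (starRingEnd ℂ)
      (thullenKernel_thullenAut_mul_jac α hw2 (norm_snd_lt_one_of_mem hz))
    rw [map_mul, map_mul, Complex.conj_ofReal] at h
    rw [hdet z hz, abs_of_nonneg (by positivity), Complex.real_smul, Complex.ofReal_pow,
      ← Complex.mul_conj']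
    simp only [hF]
    linear_combination (f (thullenAut α w.2 z) * thullenAutJac α w.2 z) * h
  rw [setIntegral_congr_fun hm hpt, integral_const_mul, hbase]
  have e0 : ((1 - ‖w.2‖ ^ 2) ^ (-(α / 2)) : ℝ) * (1 - ‖w.2‖ ^ 2) ^ (α / 2) = 1 := by
    rw [← Real.rpow_add hl]
    simp
  have e1 : thullenAut α w.2 (s, 0) = w := by
    refine Prod.ext ?_ ?_
    · simp only [thullenAut, hs, zero_mul, sub_zero, Complex.one_cpow, mul_one]
      rw [mul_assoc, ← Complex.ofReal_mul, e0]
      simp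
    · simp [thullenAut]
  have e2 : ((1 - ‖w.2‖ ^ 2) ^ (-1 - α / 2) : ℝ) *
      ((1 - ‖w.2‖ ^ 2) ^ (α / 2) * (1 - ‖w.2‖ ^ 2)) = 1 := by
    nth_rewrite 3 [← Real.rpow_one (1 - ‖w.2‖ ^ 2)]
    rw [← Real.rpow_add hl, ← Real.rpow_add hl]
    ring_nf
    exact Real.rpow_zero _
  simp only [hF]
  rw [e1]
  simp only [thullenAutJac, zero_mul, sub_zero, Complex.one_cpow, mul_one, one_pow, div_one]
  rw [← Complex.ofReal_mul, mul_left_comm, ← Complex.ofReal_mul, e2]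
  simp

/-! ### Comparing kernel values at nearby points -/

/-- The restriction of `axisKernel` to the real axis. -/
noncomputable def axisKernelReal (α t : ℝ) : ℝ :=
  ((α + 1) + (α - 1) * t) / (Real.pi ^ 2 * (1 - t) ^ 3)

theorem axisKernel_ofReal (α t : ℝ) : axisKernel α t = (axisKernelReal α t : ℝ) := by
  rw [axisKernel, axisKernelReal]
  push_cast
  rfl

theorem thullenCross_self {α : ℝ} {z : ℂ × ℂ} (hz : ‖z.2‖ < 1) :
    thullenCross α z z = (thullenRatio α z : ℝ) := by
  rw [thullenCross, ← ofReal_one_sub_norm_sq, ← Complex.ofReal_cpow (one_sub_norm_sq_pos hz).le,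
    Complex.mul_conj, Complex.normSq_eq_norm_sq, thullenRatio]
  push_cast
  rfl

theorem thullenKernel_self_re {α : ℝ} {z : ℂ × ℂ} (hz : ‖z.2‖ < 1) :
    (thullenKernel α z z).re =
      (1 - ‖z.2‖ ^ 2) ^ (-(2 + α)) * axisKernelReal α (thullenRatio α z) := by
  rw [thullenKernel, thullenCross_self hz, axisKernel_ofReal, ← ofReal_one_sub_norm_sq,
    ← Complex.ofReal_cpow (one_sub_norm_sq_pos hz).le, ← Complex.ofReal_mul, Complex.ofReal_re]

/-- The expression is affine in t, with end values α + 1 and 2α. -/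
theorem min_le_axis_numerator {α t : ℝ} (hα : 0 < α) (ht0 : 0 ≤ t) (ht1 : t ≤ 1) :
    min α 1 ≤ (α + 1) + (α - 1) * t := by
  rcases le_total α 1 with h | h
  · rw [min_eq_left h]; nlinarith
  · rw [min_eq_right h]; nlinarith

theorem axisKernelReal_pos {α t : ℝ} (hα : 0 < α) (ht0 : 0 ≤ t) (ht1 : t < 1) :
    0 < axisKernelReal α t := by
  have h1 := min_le_axis_numerator hα ht0 ht1.le
  have h2 : 0 < min α 1 := lt_min hα one_pos
  have h3 : 0 < 1 - t := by linarith
  exact div_pos (by linarith) (by positivity)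

/-- Moving t by at most η(1 - t) changes 1 - t by a factor between 1 - η and 1 + η. It changes the
numerator by a relative error of at most η |α - 1| / min α 1, as the numerator is at least min α 1.
The resulting factor tends to 1 as η → 0. -/
theorem axisKernel_lower_bound {α t t' η : ℝ} {X : ℂ} (hα : 0 < α) (ht0 : 0 ≤ t) (ht1 : t < 1)
    (hη0 : 0 ≤ η) (hη1 : η < 1) (hCη : |α - 1| / min α 1 * η ≤ 1)
    (hX : ‖X - t‖ ≤ η * (1 - t)) (hX1 : X ≠ 1) (ht' : |t' - t| ≤ η * (1 - t)) :
    (1 - |α - 1| / min α 1 * η) ^ 2 * (1 - η) ^ 3 / ((1 + η) ^ 6 * (1 + |α - 1| / min α 1 * η)) *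
      (axisKernelReal α t * axisKernelReal α t') ≤ ‖axisKernel α X‖ ^ 2 := by
  obtain ⟨ν, hν⟩ : ∃ ν, ν = min α 1 := ⟨_, rfl⟩
  have hν0 : 0 < ν := hν ▸ lt_min hα one_pos
  rw [← hν] at hCη ⊢
  obtain ⟨C, hC⟩ : ∃ C, C = |α - 1| / ν := ⟨_, rfl⟩
  have hC0 : 0 ≤ C := by rw [hC]; positivity
  have hCν : C * ν = |α - 1| := by rw [hC, div_mul_cancel₀ _ hν0.ne']
  rw [← hC] at hCη ⊢
  obtain ⟨h, hh⟩ : ∃ h, h = 1 - t := ⟨_, rfl⟩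
  rw [← hh] at hX ht'
  have hh0 : 0 < h := by linarith
  have hh1 : h ≤ 1 := by linarith
  obtain ⟨n, hn⟩ : ∃ n, n = (α + 1) + (α - 1) * t := ⟨_, rfl⟩
  have hnν : ν ≤ n := by rw [hn, hν]; exact min_le_axis_numerator hα ht0 ht1.le
  have hn0 : 0 < n := hν0.trans_le hnν
  have hηh : η * h ≤ η := mul_le_of_le_one_right hη0 hh1
  have hdiff : |α - 1| * (η * h) ≤ C * η * n := by
    calc |α - 1| * (η * h) ≤ |α - 1| * η := by gcongr
      _ = C * η * ν := by rw [← hCν]; ring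
      _ ≤ C * η * n := by gcongr
  have hn' : (α + 1) + (α - 1) * t' ≤ n * (1 + C * η) := by
    have h1 : (α - 1) * (t' - t) ≤ |α - 1| * (η * h) :=
      (le_abs_self _).trans (by rw [abs_mul]; gcongr)
    linarith
  have ht'1 : h * (1 - η) ≤ 1 - t' := by
    have := (abs_le.mp ht').2
    linarith
  have h1η : 0 < 1 - η := by linarith
  have hR' : axisKernelReal α t' ≤ n * (1 + C * η) / (Real.pi ^ 2 * (h * (1 - η)) ^ 3) := by
    rw [axisKernelReal]
    have := Real.pi_pos
    gcongr
  have hnX : n * (1 - C * η) ≤ ‖(α : ℂ) + 1 + (α - 1) * X‖ := by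
    have e : (α : ℂ) + 1 + (α - 1) * X = (n : ℝ) - (-((α - 1 : ℝ) * (X - t))) := by
      rw [hn]; push_cast; ring
    rw [e]
    refine le_trans ?_ (norm_sub_norm_le _ _)
    rw [norm_neg, norm_mul, Complex.norm_real, Complex.norm_real, Real.norm_of_nonneg hn0.le,
      Real.norm_eq_abs]
    have : |α - 1| * ‖X - t‖ ≤ |α - 1| * (η * h) := by gcongr
    linarith
  have hX' : ‖1 - X‖ ≤ h * (1 + η) := by
    have e : 1 - X = (h : ℝ) - (X - t) := by rw [hh]; push_cast; ring
    rw [e]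
    refine (norm_sub_le _ _).trans ?_
    rw [Complex.norm_real, Real.norm_of_nonneg hh0.le]
    linarith
  have hX0 : 0 < ‖1 - X‖ := norm_pos_iff.mpr (sub_ne_zero.mpr hX1.symm)
  have hlow : n * (1 - C * η) / (Real.pi ^ 2 * (h * (1 + η)) ^ 3) ≤ ‖axisKernel α X‖ := by
    rw [axisKernel, norm_div, norm_mul, norm_pow, norm_pow, Complex.norm_real,
      Real.norm_of_nonneg Real.pi_pos.le]
    have := Real.pi_pos
    gcongr
  have hR : axisKernelReal α t = n / (Real.pi ^ 2 * h ^ 3) := by rw [axisKernelReal, hn, hh]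
  have hlow0 : 0 ≤ n * (1 - C * η) / (Real.pi ^ 2 * (h * (1 + η)) ^ 3) := by
    have : 0 ≤ 1 - C * η := by linarith
    positivity
  refine le_trans ?_ (pow_le_pow_left₀ hlow0 hlow 2)
  have h1C : 0 < 1 + C * η := by positivity
  calc (1 - C * η) ^ 2 * (1 - η) ^ 3 / ((1 + η) ^ 6 * (1 + C * η)) *
        (axisKernelReal α t * axisKernelReal α t')
      ≤ (1 - C * η) ^ 2 * (1 - η) ^ 3 / ((1 + η) ^ 6 * (1 + C * η)) *
        (axisKernelReal α t * (n * (1 + C * η) / (Real.pi ^ 2 * (h * (1 - η)) ^ 3))) := by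
        have := (axisKernelReal_pos hα ht0 ht1).le
        gcongr
    _ = _ := by
        rw [hR]
        have := Real.pi_ne_zero
        field_simp

theorem tendsto_kernel_comparison (α C : ℝ) :
    Filter.Tendsto (fun η : ℝ => (1 - η) ^ (2 + α) *
      ((1 - C * η) ^ 2 * (1 - η) ^ 3 / ((1 + η) ^ 6 * (1 + C * η)))) (nhds 0) (nhds 1) := by
  have h1 : ContinuousAt (fun η : ℝ => (1 - η) ^ (2 + α)) 0 :=
    (by fun_prop : ContinuousAt (fun η : ℝ => 1 - η) 0).rpow_const (Or.inl (by norm_num))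
  have h2 : ContinuousAt (fun η : ℝ => (1 - η) ^ (2 + α) *
      ((1 - C * η) ^ 2 * (1 - η) ^ 3 / ((1 + η) ^ 6 * (1 + C * η)))) 0 :=
    h1.mul (ContinuousAt.div (by fun_prop) (by fun_prop) (by norm_num))
  simpa [ContinuousAt] using h2

theorem skwarczynskiDist_thullenDomain_lt {α : ℝ} (hα : 0 < α) {ε : ℝ} (hε : 0 < ε) :
    ∃ η₀ > 0, ∀ η, 0 ≤ η → η < η₀ → ∀ x ∈ thullenDomain α, ∀ w ∈ thullenDomain α,
      (1 - η) * ‖1 - w.2 * (starRingEnd ℂ) x.2‖ ^ 2 ≤ (1 - ‖x.2‖ ^ 2) * (1 - ‖w.2‖ ^ 2) →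
      ‖thullenCross α w x - thullenRatio α x‖ ≤ η * (1 - thullenRatio α x) →
      |thullenRatio α w - thullenRatio α x| ≤ η * (1 - thullenRatio α x) →
      skwarczynskiDist (thullenDomain α) w x < ε := by
  set C := |α - 1| / min α 1 with hC
  have hC0 : 0 ≤ C := div_nonneg (abs_nonneg _) (le_min hα.le zero_le_one)
  set M := max 0 (1 - ε ^ 2) with hM
  have hM0 : 0 ≤ M := le_max_left _ _
  -- The distance is below ε once the normalised kernel exceeds M; the maximum with 0 allows
  -- squaring when ε > 1.
  have hM1 : M ^ 2 < 1 := by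
    have : M < 1 := max_lt one_pos (by nlinarith)
    nlinarith
  obtain ⟨η₁, hη₁, hη⟩ := Metric.eventually_nhds_iff.mp
    ((tendsto_kernel_comparison α C).eventually (lt_mem_nhds hM1))
  -- The bound 1 keeps 1 - η positive, and 1 / (C + 1) ensures C η ≤ 1.
  refine ⟨min η₁ (min 1 (1 / (C + 1))), by positivity, ?_⟩
  intro η hη0 hηlt x hx w hw hA hX ht
  have hx2 := norm_snd_lt_one_of_mem hx
  have hw2 := norm_snd_lt_one_of_mem hw
  have hxt := ((mem_thullenDomain_iff hα).mp hx).2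
  have hwt := ((mem_thullenDomain_iff hα).mp hw).2
  have hη1 : η < 1 := hηlt.trans_le ((min_le_right _ _).trans (min_le_left _ _))
  have hηC : C * η ≤ 1 := by
    have : η < 1 / (C + 1) := hηlt.trans_le ((min_le_right _ _).trans (min_le_right _ _))
    rw [lt_div_iff₀ (by positivity)] at this
    nlinarith
  have hq := hη (y := η) (by
    rw [Real.dist_eq, sub_zero, abs_of_nonneg hη0]
    exact hηlt.trans_le (min_le_left _ _))
  have hX1 : thullenCross α w x ≠ 1 := fun h => by
    have := norm_thullenCross_lt_one hα hw hx
    rw [h, norm_one] at this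
    exact lt_irrefl _ this
  have haxis := axisKernel_lower_bound hα (thullenRatio_nonneg hx2) hxt hη0 hη1 hηC hX hX1 ht
  rw [← hC] at haxis
  set q := (1 - C * η) ^ 2 * (1 - η) ^ 3 / ((1 + η) ^ 6 * (1 + C * η)) with hq'
  have hlx := one_sub_norm_sq_pos hx2
  have hlw := one_sub_norm_sq_pos hw2
  have hu := norm_pos_iff.mpr (one_sub_mul_conj_ne_zero hw2 hx2)
  have h1η : 0 < 1 - η := by linarith
  have hRx := axisKernelReal_pos hα (thullenRatio_nonneg hx2) hxt
  have hRw := axisKernelReal_pos hα (thullenRatio_nonneg hw2) hwt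
  have hpow : (1 - η) ^ (2 + α) * ((1 - ‖x.2‖ ^ 2) ^ (-(2 + α)) * (1 - ‖w.2‖ ^ 2) ^ (-(2 + α))) ≤
      (‖1 - w.2 * (starRingEnd ℂ) x.2‖ ^ (-(2 + α))) ^ 2 := by
    have e1 : (‖1 - w.2 * (starRingEnd ℂ) x.2‖ ^ (-(2 + α))) ^ 2 =
        (‖1 - w.2 * (starRingEnd ℂ) x.2‖ ^ 2) ^ (-(2 + α)) := by
      rw [← Real.rpow_natCast, ← Real.rpow_natCast, ← Real.rpow_mul hu.le, ← Real.rpow_mul hu.le,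
        mul_comm (-(2 + α))]
    have e2 : (1 - η) ^ (2 + α) = (1 - η)⁻¹ ^ (-(2 + α)) := by
      rw [Real.inv_rpow h1η.le, ← Real.rpow_neg h1η.le, neg_neg]
    rw [e1, e2, ← Real.mul_rpow hlx.le hlw.le, ← Real.mul_rpow (by positivity) (by positivity)]
    refine Real.rpow_le_rpow_of_nonpos (by positivity) ?_ (by linarith)
    rw [inv_mul_eq_div, le_div_iff₀ h1η, mul_comm]
    exact hA
  have hK := isBergmanKernel_thullenKernel hα
  have hKx := thullenKernel_self_re (α := α) hx2
  have hKw := thullenKernel_self_re (α := α) hw2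
  have hKx0 : 0 < (thullenKernel α x x).re := by rw [hKx]; positivity
  have hKw0 : 0 < (thullenKernel α w w).re := by rw [hKw]; positivity
  have hq0 : 0 ≤ q := by
    have : 0 ≤ 1 - C * η := by linarith
    positivity
  have hmain : ((1 - η) ^ (2 + α) * q) * ((thullenKernel α w w).re * (thullenKernel α x x).re) ≤
      ‖thullenKernel α w x‖ ^ 2 := by
    rw [hKx, hKw, thullenKernel, norm_mul, mul_pow, Complex.norm_cpow_real]
    calc _ = ((1 - η) ^ (2 + α) * ((1 - ‖x.2‖ ^ 2) ^ (-(2 + α)) * (1 - ‖w.2‖ ^ 2) ^ (-(2 + α)))) *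
          (q * (axisKernelReal α (thullenRatio α x) * axisKernelReal α (thullenRatio α w))) := by
          ring
      _ ≤ _ := by gcongr
  rw [skwarczynskiDist, bergmanKernel_eq hK hw hx, bergmanKernel_eq hK hx hx,
    bergmanKernel_eq hK hw hw, Real.sqrt_lt' hε, ← Real.sqrt_mul hKw0.le]
  have hS : 0 < (thullenKernel α w w).re * (thullenKernel α x x).re := by positivity
  have hMlt : M < ‖thullenKernel α w x‖ / √((thullenKernel α w w).re * (thullenKernel α x x).re) := by
    rw [lt_div_iff₀ (Real.sqrt_pos.mpr hS)]
    refine lt_of_pow_lt_pow_left₀ 2 (norm_nonneg _) ?_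
    rw [mul_pow, Real.sq_sqrt hS.le]
    exact (mul_lt_mul_of_pos_right hq hS).trans_le hmain
  have := le_max_right 0 (1 - ε ^ 2)
  linarith

/-! ### Polydisc-like neighbourhoods -/

/-- The fibre over y is a disc whose centre moves with y but whose area does not, so Fubini gives a
product. -/
theorem volume_real_shear (g : ℂ → ℂ) (hg : Measurable g) (a : ℂ) {r₁ r₂ : ℝ} (hr₁ : 0 ≤ r₁)
    (hr₂ : 0 ≤ r₂) :
    MeasurableSet {w : ℂ × ℂ | ‖w.2 - a‖ < r₂ ∧ ‖w.1 - g w.2‖ < r₁} ∧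
    (volume : Measure (ℂ × ℂ)).real {w | ‖w.2 - a‖ < r₂ ∧ ‖w.1 - g w.2‖ < r₁} =
      Real.pi ^ 2 * r₁ ^ 2 * r₂ ^ 2 := by
  have hm : MeasurableSet {w : ℂ × ℂ | ‖w.2 - a‖ < r₂ ∧ ‖w.1 - g w.2‖ < r₁} := by
    exact (measurableSet_lt (measurable_snd.sub_const a).norm measurable_const).inter
      (measurableSet_lt (measurable_fst.sub (hg.comp measurable_snd)).norm measurable_const)
  refine ⟨hm, ?_⟩
  have hfib : ∀ y : ℂ, volume ((fun x : ℂ => (x, y)) ⁻¹'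
      {w : ℂ × ℂ | ‖w.2 - a‖ < r₂ ∧ ‖w.1 - g w.2‖ < r₁}) =
      (Metric.ball a r₂).indicator (fun _ => volume (Metric.ball (0 : ℂ) r₁)) y := by
    intro y
    by_cases hy : y ∈ Metric.ball a r₂
    · rw [Set.indicator_of_mem hy, Complex.volume_ball, ← Complex.volume_ball (g y)]
      congr 1
      ext x
      rw [mem_ball_iff_norm] at hy
      simp [dist_eq_norm, hy]
    · rw [Set.indicator_of_notMem hy]
      rw [mem_ball_iff_norm] at hy
      simp [hy]
  rw [measureReal_def, Measure.volume_eq_prod, Measure.prod_apply_symm hm]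
  simp only [hfib]
  rw [lintegral_indicator_const measurableSet_ball, Complex.volume_ball, Complex.volume_ball]
  simp only [ENNReal.toReal_mul, ENNReal.toReal_pow, ENNReal.toReal_ofReal hr₁,
    ENNReal.toReal_ofReal hr₂, ENNReal.coe_toReal, NNReal.coe_real_pi]
  ring

/-- Combine -log(1 - y) ≤ 2y on [0, 1/2] with exp s ≤ 1 + s exp s at s = 2αy ≤ α. -/
theorem rpow_neg_le_one_add {α y : ℝ} (hα : 0 < α) (hy0 : 0 ≤ y) (hy1 : y ≤ 1 / 2) :
    (1 - y) ^ (-α) ≤ 1 + 2 * α * Real.exp α * y := by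
  have h1 : 0 < 1 - y := by linarith
  have hlog : -(2 * y) ≤ Real.log (1 - y) := by
    have h2 := Real.one_sub_inv_le_log_of_pos h1
    have h3 : (1 - y)⁻¹ ≤ 1 + 2 * y := by
      rw [inv_le_iff_one_le_mul₀ h1]
      nlinarith
    linarith
  have h2 : (1 - y) ^ (-α) ≤ Real.exp (2 * α * y) := by
    rw [Real.rpow_def_of_pos h1]
    refine Real.exp_le_exp.mpr ?_
    nlinarith
  have h3 : Real.exp (2 * α * y) ≤ 1 + 2 * α * y * Real.exp (2 * α * y) := by
    have h4 := Real.add_one_le_exp (-(2 * α * y))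
    have h5 : Real.exp (-(2 * α * y)) * Real.exp (2 * α * y) = 1 := by
      rw [← Real.exp_add]; simp
    nlinarith [Real.exp_pos (2 * α * y)]
  have h4 : Real.exp (2 * α * y) ≤ Real.exp α := Real.exp_le_exp.mpr (by nlinarith)
  have h5 : 2 * α * y * Real.exp (2 * α * y) ≤ 2 * α * y * Real.exp α := by gcongr
  linarith

/-- A neighbourhood of `x` in the Thullen domain that is comparable to a Skwarczyński ball. -/
def thullenPolydisc (α c : ℝ) (x : ℂ × ℂ) : Set (ℂ × ℂ) :=
  {w | ‖w.2 - x.2‖ < c * √(1 - thullenRatio α x) * (1 - ‖x.2‖ ^ 2) ∧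
    ‖w.1 - x.1 * ((1 - w.2 * (starRingEnd ℂ) x.2) / (1 - ‖x.2‖ ^ 2 : ℝ)) ^ (α : ℂ)‖ <
      c * (1 - thullenRatio α x) * (1 - ‖x.2‖ ^ 2) ^ (α / 2)}

theorem volume_real_thullenPolydisc {α c : ℝ} (hα : 0 < α) (hc : 0 ≤ c) {x : ℂ × ℂ}
    (hx : x ∈ thullenDomain α) :
    MeasurableSet (thullenPolydisc α c x) ∧ volume.real (thullenPolydisc α c x) =
      Real.pi ^ 2 * c ^ 4 * (1 - thullenRatio α x) ^ 3 * (1 - ‖x.2‖ ^ 2) ^ (2 + α) := by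
  have hl := one_sub_norm_sq_pos (norm_snd_lt_one_of_mem hx)
  have hh : 0 < 1 - thullenRatio α x := sub_pos.mpr ((mem_thullenDomain_iff hα).mp hx).2
  have h := volume_real_shear
    (fun y => x.1 * ((1 - y * (starRingEnd ℂ) x.2) / (1 - ‖x.2‖ ^ 2 : ℝ)) ^ (α : ℂ))
    (by fun_prop) x.2 (r₁ := c * (1 - thullenRatio α x) * (1 - ‖x.2‖ ^ 2) ^ (α / 2))
    (r₂ := c * √(1 - thullenRatio α x) * (1 - ‖x.2‖ ^ 2)) (by positivity) (by positivity)
  refine ⟨h.1, h.2.trans ?_⟩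
  have e1 : ((1 - ‖x.2‖ ^ 2) ^ (α / 2)) ^ 2 * (1 - ‖x.2‖ ^ 2) ^ 2 =
      (1 - ‖x.2‖ ^ 2) ^ (2 + α) := by
    rw [← Real.rpow_natCast, ← Real.rpow_mul hl.le, ← Real.rpow_natCast (1 - ‖x.2‖ ^ 2),
      ← Real.rpow_add hl]
    congr 1
    push_cast
    ring
  rw [← e1, mul_pow, mul_pow, mul_pow, mul_pow, Real.sq_sqrt hh.le]
  ring

/-- Here y is the squared pseudo-hyperbolic distance of a and b, at most 2c²h. The factor √h in the
radius makes this error of order h rather than √h. -/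
theorem exists_one_sub_norm_sq_eq {a b : ℂ} {c h l : ℝ} {v : ℂ} (ha : ‖a‖ < 1) (hc : 0 ≤ c)
    (hc4 : c ≤ 1 / 4) (hh0 : 0 ≤ h) (hh1 : h ≤ 1) (hl : l = 1 - ‖a‖ ^ 2)
    (hb : ‖b - a‖ < c * √h * l) (hv : v = (1 - b * (starRingEnd ℂ) a) / (l : ℂ)) :
    3 / 4 ≤ ‖v‖ ∧ ‖v‖ ≤ 5 / 4 ∧
      ∃ y, 0 ≤ y ∧ y ≤ c * h / 2 ∧ 1 - ‖b‖ ^ 2 = (1 - y) * (l * ‖v‖ ^ 2) := by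
  have hl0 : 0 < l := hl ▸ one_sub_norm_sq_pos ha
  have hsh1 : √h ≤ 1 := Real.sqrt_le_one.mpr hh1
  have hlC : (l : ℂ) ≠ 0 := by exact_mod_cast hl0.ne'
  have hlv : 1 - b * (starRingEnd ℂ) a = l * v := by rw [hv, mul_div_cancel₀ _ hlC]
  have hv1 : ‖v - 1‖ ≤ 1 / 4 := by
    have e : v - 1 = -((b - a) * (starRingEnd ℂ) a) / (l : ℂ) := by
      rw [hv, eq_div_iff hlC, sub_mul, div_mul_cancel₀ _ hlC, one_mul, hl, ofReal_one_sub_norm_sq]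
      ring
    rw [e, norm_div, norm_neg, norm_mul, RCLike.norm_conj, Complex.norm_real,
      Real.norm_of_nonneg hl0.le, div_le_iff₀ hl0]
    calc ‖b - a‖ * ‖a‖ ≤ (c * √h * l) * 1 := by gcongr
      _ ≤ (1 / 4 * 1 * l) * 1 := by gcongr
      _ = 1 / 4 * l := by ring
  have hvlow : 3 / 4 ≤ ‖v‖ := by
    have := norm_sub_norm_le (1 : ℂ) (1 - v)
    rw [norm_one, sub_sub_cancel, norm_sub_rev] at this
    linarith
  have hvhigh : ‖v‖ ≤ 5 / 4 := by
    have := norm_add_le (v - 1) 1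
    rw [norm_one, sub_add_cancel] at this
    linarith
  have hnorm : (l * ‖v‖) ^ 2 = ‖b - a‖ ^ 2 + (1 - ‖b‖ ^ 2) * l := by
    have := norm_one_sub_mul_conj_sq b a
    rw [hlv, norm_mul, Complex.norm_real, Real.norm_of_nonneg hl0.le, ← hl] at this
    exact this
  have hdsq : ‖b - a‖ ^ 2 ≤ c ^ 2 * h * l ^ 2 := by
    calc ‖b - a‖ ^ 2 ≤ (c * √h * l) ^ 2 := by gcongr
      _ = c ^ 2 * h * l ^ 2 := by rw [mul_pow, mul_pow, Real.sq_sqrt hh0]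
  have hvsq : 9 / 16 ≤ ‖v‖ ^ 2 := by
    calc (9 / 16 : ℝ) = (3 / 4) ^ 2 := by norm_num
      _ ≤ ‖v‖ ^ 2 := by gcongr
  obtain ⟨y, hy⟩ : ∃ y, y = ‖b - a‖ ^ 2 / (l * ‖v‖) ^ 2 := ⟨_, rfl⟩
  have hlv0 : 0 < (l * ‖v‖) ^ 2 := by positivity
  have hy0 : 0 ≤ y := by rw [hy]; positivity
  have hyc : y ≤ 2 * c ^ 2 * h := by
    rw [hy, div_le_iff₀ hlv0, mul_pow]
    have : c ^ 2 * h * l ^ 2 * 1 ≤ c ^ 2 * h * l ^ 2 * (2 * ‖v‖ ^ 2) := by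
      gcongr
      linarith
    linarith
  refine ⟨hvlow, hvhigh, y, hy0, ?_, ?_⟩
  · have hc2 : c * (c * h) ≤ 1 / 4 * (c * h) := by gcongr
    linarith
  · have e : y * (l * ‖v‖) ^ 2 = ‖b - a‖ ^ 2 := by rw [hy, div_mul_cancel₀ _ hlv0.ne']
    rw [← e] at hnorm
    refine mul_right_cancel₀ hl0.ne' ?_
    linarith

/-- In the rescaled coordinates p = x₁ l^(-α/2) and q = w₁ l^(-α/2) v^(-α), the ratio at x is |p|²,
the cross term is q p̄, and the ratio at w is |q|² (1 - y)^(-α). The shear in `thullenPolydisc` is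
centred where q = p, so all errors follow from |q - p| ≤ E c h and y ≤ c h / 2. -/
theorem exists_thullenPolydisc_estimate {α : ℝ} (hα : 0 < α) :
    ∃ D > 0, ∀ c, 0 < c → D * c < 1 → ∀ x ∈ thullenDomain α, ∀ w ∈ thullenPolydisc α c x,
      w ∈ thullenDomain α ∧
      (1 - D * c) * ‖1 - w.2 * (starRingEnd ℂ) x.2‖ ^ 2 ≤ (1 - ‖x.2‖ ^ 2) * (1 - ‖w.2‖ ^ 2) ∧
      ‖thullenCross α w x - thullenRatio α x‖ ≤ D * c * (1 - thullenRatio α x) ∧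
      |thullenRatio α w - thullenRatio α x| ≤ D * c * (1 - thullenRatio α x) ∧
      1 - ‖w.2‖ ^ 2 ≤ 2 * (1 - ‖x.2‖ ^ 2) := by
  obtain ⟨E, hE⟩ : ∃ E, E = (3 / 4 : ℝ) ^ (-α) := ⟨_, rfl⟩
  have hE1 : 1 ≤ E := by
    rw [hE]
    exact Real.one_le_rpow_of_pos_of_le_one_of_nonpos (by norm_num) (by norm_num) (by linarith)
  obtain ⟨B, hB⟩ : ∃ B, B = 2 * α * Real.exp α := ⟨_, rfl⟩
  have hB0 : 0 < B := by rw [hB]; positivity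
  -- The ratio needs 3E from |q|² - |p|² and at most 4B from (1 - y)^(-α); the excess also yields c
  -- E ≤ 1/4 from D c < 1.
  refine ⟨4 * E + 8 * B, by positivity, fun c hc hDc x hx w hw => ?_⟩
  have hx2 := norm_snd_lt_one_of_mem hx
  have hxt := ((mem_thullenDomain_iff hα).mp hx).2
  have ht0 := thullenRatio_nonneg (α := α) hx2
  obtain ⟨hw2, hw1⟩ := hw
  obtain ⟨t, ht⟩ : ∃ t, t = thullenRatio α x := ⟨_, rfl⟩
  rw [← ht] at hxt ht0 hw2 hw1 ⊢
  obtain ⟨h, hh⟩ : ∃ h, h = 1 - t := ⟨_, rfl⟩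
  have hh0 : 0 < h := by linarith
  have hh1 : h ≤ 1 := by linarith
  obtain ⟨l, hl⟩ : ∃ l, l = 1 - ‖x.2‖ ^ 2 := ⟨_, rfl⟩
  have hl0 : 0 < l := hl ▸ one_sub_norm_sq_pos hx2
  rw [← hh, ← hl] at hw1 hw2
  rw [← hl, ← hh]
  have hcB : 0 ≤ c * B := by positivity
  have hcE : c * E ≤ 1 / 4 := by linarith
  have hc4 : c ≤ 1 / 4 := (le_mul_of_one_le_right hc.le hE1).trans hcE
  obtain ⟨v, hv⟩ : ∃ v, v = (1 - w.2 * (starRingEnd ℂ) x.2) / (l : ℂ) := ⟨_, rfl⟩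
  rw [← hv] at hw1
  have hlC : (l : ℂ) ≠ 0 := by exact_mod_cast hl0.ne'
  have hlv : 1 - w.2 * (starRingEnd ℂ) x.2 = l * v := by rw [hv, mul_div_cancel₀ _ hlC]
  obtain ⟨hvlow, hvhigh, y, hy0, hyc', hlw⟩ :=
    exists_one_sub_norm_sq_eq hx2 hc.le hc4 hh0.le hh1 hl hw2 hv
  have hv0 : v ≠ 0 := norm_pos_iff.mp (by linarith)
  have hych : c * h ≤ 1 / 4 := (mul_le_of_le_one_right hc.le hh1).trans hc4
  have hy1 : y ≤ 1 / 8 := by linarith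
  have hlw0 : 0 < 1 - ‖w.2‖ ^ 2 := by
    rw [hlw]
    have : 0 < 1 - y := by linarith
    positivity
  have hw21 : ‖w.2‖ < 1 := (sq_lt_one_iff₀ (norm_nonneg _)).mp (sub_pos.mp hlw0)
  have hla : (((l ^ (-(α / 2)) : ℝ) : ℂ)) * ((l ^ (α / 2) : ℝ) : ℂ) = 1 := by
    rw [← Complex.ofReal_mul, ← Real.rpow_add hl0]
    simp
  obtain ⟨p, hp⟩ : ∃ p : ℂ, p = x.1 * (l ^ (-(α / 2)) : ℝ) := ⟨_, rfl⟩
  have hlsq : l ^ (-(α / 2)) * l ^ (-(α / 2)) = l ^ (-α) := by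
    rw [← Real.rpow_add hl0]
    ring_nf
  have hpt : ‖p‖ ^ 2 = t := by
    rw [hp, norm_mul, Complex.norm_real, Real.norm_of_nonneg (Real.rpow_nonneg hl0.le _), mul_pow,
      sq (l ^ _), hlsq, ht, thullenRatio, hl]
  have hp1 : ‖p‖ ≤ 1 := (sq_le_one_iff₀ (norm_nonneg p)).mp (hpt.trans_le hxt.le)
  obtain ⟨q, hq⟩ : ∃ q : ℂ, q = w.1 * (l ^ (-(α / 2)) : ℝ) * v ^ ((-α : ℝ) : ℂ) := ⟨_, rfl⟩
  have hvv : v ^ (α : ℂ) * v ^ ((-α : ℝ) : ℂ) = 1 := by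
    rw [← Complex.cpow_add _ _ hv0]
    simp
  have hqp : ‖q - p‖ ≤ E * (c * h) := by
    have e : q - p = (w.1 - x.1 * v ^ (α : ℂ)) * (l ^ (-(α / 2)) : ℝ) * v ^ ((-α : ℝ) : ℂ) := by
      rw [hq, hp]
      linear_combination (x.1 * (l ^ (-(α / 2)) : ℝ)) * hvv
    have hvE : ‖v‖ ^ (-α) ≤ E := by
      rw [hE]
      exact Real.rpow_le_rpow_of_nonpos (by norm_num) hvlow (by linarith)
    rw [e, norm_mul, norm_mul, Complex.norm_cpow_real, Complex.norm_real,
      Real.norm_of_nonneg (Real.rpow_nonneg hl0.le _)]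
    have hla' : l ^ (α / 2) * l ^ (-(α / 2)) = 1 := by
      rw [← Real.rpow_add hl0]
      simp
    calc _ ≤ (c * h * l ^ (α / 2)) * l ^ (-(α / 2)) * E := by gcongr
      _ = E * (c * h) := by linear_combination (c * h * E) * hla'
  have hqp1 : ‖q - p‖ ≤ 1 / 4 := hqp.trans <| by
    have : c * E * h ≤ 1 / 4 * 1 := by gcongr
    linarith
  have hcross : thullenCross α w x = q * (starRingEnd ℂ) p := by
    rw [thullenCross, hlv, ofReal_mul_cpow hl0 hv0, ← hlsq, hq, hp, map_mul, Complex.conj_ofReal]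
    push_cast
    ring
  have hX : ‖thullenCross α w x - t‖ ≤ E * (c * h) := by
    have e : thullenCross α w x - t = (q - p) * (starRingEnd ℂ) p := by
      rw [hcross, ← hpt, Complex.ofReal_pow, ← Complex.mul_conj']
      ring
    rw [e, norm_mul, RCLike.norm_conj]
    exact (mul_le_of_le_one_right (norm_nonneg _) hp1).trans hqp
  have htw : thullenRatio α w = ‖q‖ ^ 2 * (1 - y) ^ (-α) := by
    have e1 : (‖v‖ ^ 2) ^ (-α) = (‖v‖ ^ (-α)) ^ 2 := by
      rw [← Real.rpow_natCast, ← Real.rpow_natCast, ← Real.rpow_mul (norm_nonneg _),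
        ← Real.rpow_mul (norm_nonneg _), mul_comm (-α)]
    rw [thullenRatio, hlw, Real.mul_rpow (by linarith) (by positivity),
      Real.mul_rpow hl0.le (by positivity), e1, ← hlsq, hq, norm_mul, norm_mul,
      Complex.norm_cpow_real, Complex.norm_real,
      Real.norm_of_nonneg (Real.rpow_nonneg hl0.le _)]
    ring
  have hqn : |‖q‖ - ‖p‖| ≤ E * (c * h) := (abs_norm_sub_norm_le q p).trans hqp
  have hqn1 := abs_le.mp hqn
  have hqsq : |‖q‖ ^ 2 - t| ≤ 3 * (E * (c * h)) := by
    rw [← hpt, show ‖q‖ ^ 2 - ‖p‖ ^ 2 = (‖q‖ - ‖p‖) * (‖q‖ + ‖p‖) by ring, abs_mul,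
      abs_of_nonneg (add_nonneg (norm_nonneg q) (norm_nonneg p)), mul_comm]
    have : ‖q‖ ≤ 2 := by
      have := norm_add_le (q - p) p
      rw [sub_add_cancel] at this
      linarith
    gcongr
    linarith
  have hq4 : ‖q‖ ^ 2 ≤ 4 := by
    have := (abs_le.mp hqsq).2
    have : c * E * h ≤ 1 / 4 * 1 := by gcongr
    linarith
  have hyα := rpow_neg_le_one_add hα hy0 (by linarith : y ≤ 1 / 2)
  rw [← hB] at hyα
  have hyα1 : 1 ≤ (1 - y) ^ (-α) :=
    Real.one_le_rpow_of_pos_of_le_one_of_nonpos (by linarith) (by linarith) (by linarith)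
  have hBy : B * y ≤ B * (c * h) := mul_le_mul_of_nonneg_left (by linarith [hy0]) hB0.le
  have htw' : |thullenRatio α w - t| ≤ (4 * E + 8 * B) * c * h := by
    have h1 := abs_le.mp hqsq
    have h2 : 0 ≤ ‖q‖ ^ 2 * ((1 - y) ^ (-α) - 1) := mul_nonneg (sq_nonneg _) (by linarith)
    have h3 : ‖q‖ ^ 2 * ((1 - y) ^ (-α) - 1) ≤ 4 * (B * (c * h)) := by
      refine mul_le_mul hq4 (by linarith) (by linarith) (by norm_num)
    have h4 : 0 ≤ E * (c * h) := by positivity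
    have h5 : 0 ≤ B * (c * h) := by positivity
    rw [htw, abs_le]
    constructor <;> linarith
  refine ⟨(mem_thullenDomain_iff hα).mpr ⟨hw21, ?_⟩, ?_, ?_, htw', ?_⟩
  · have h1 := (abs_le.mp htw').2
    have h2 : (4 * E + 8 * B) * c * h < 1 * h := by gcongr
    linarith
  · rw [hlv, norm_mul, Complex.norm_real, Real.norm_of_nonneg hl0.le, hlw]
    have h1 : (1 - (4 * E + 8 * B) * c) ≤ 1 - y := by
      have h2 : c * h ≤ c := mul_le_of_le_one_right hc.le hh1
      have h3 : c * 1 ≤ c * E := by gcongr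
      have h4 : 0 ≤ c * B := by positivity
      linarith
    calc _ ≤ (1 - y) * (l * ‖v‖) ^ 2 := by gcongr
      _ = _ := by ring
  · refine hX.trans ?_
    have h4 : 0 ≤ E * (c * h) := by positivity
    have h5 : 0 ≤ B * (c * h) := by positivity
    linarith
  · rw [hlw]
    have h1 : ‖v‖ ^ 2 ≤ 2 := by
      calc ‖v‖ ^ 2 ≤ (5 / 4) ^ 2 := by gcongr
        _ ≤ 2 := by norm_num
    have h2 : (1 - y) * (l * ‖v‖ ^ 2) ≤ 1 * (l * 2) := by
      gcongr
      linarith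
    linarith

theorem exists_thullen_packing_sets {α : ℝ} (hα : 0 < α) :
    ∀ ε > 0, ∃ κ > 0, ∀ x : thullenDomain α, ∃ P ⊆ thullenDomain α, MeasurableSet P ∧
      (∀ w ∈ P, skwarczynskiDist (thullenDomain α) x w < ε) ∧ 0 < volume.real P ∧
      ∀ w ∈ P, κ ≤ volume.real P * (thullenKernel α w w).re := by
  intro ε hε
  obtain ⟨D, hD, hest⟩ := exists_thullenPolydisc_estimate hα
  obtain ⟨η₀, hη₀, hdist⟩ := skwarczynskiDist_thullenDomain_lt hα hε
  obtain ⟨c, hc0, hc⟩ : ∃ c, 0 < c ∧ D * c < min η₀ 1 := by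
    have hm : 0 < min η₀ 1 := lt_min hη₀ one_pos
    refine ⟨min η₀ 1 / (2 * D), by positivity, ?_⟩
    rw [mul_div_assoc', div_lt_iff₀ (by positivity)]
    nlinarith
  have hc1 : D * c < 1 := hc.trans_le (min_le_right _ _)
  have hK := isBergmanKernel_thullenKernel hα
  have hν : 0 < min α 1 := lt_min hα one_pos
  -- Passing from x to w costs 2^(-(2+α)) in the power of l and 2³ in the power of h; min α 1 bounds
  -- the numerator of the axis kernel, and π² cancels.
  refine ⟨c ^ 4 * 2 ^ (-(2 + α)) * (min α 1 / 8), by positivity, fun x =>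
    ⟨thullenPolydisc α c x, fun w hw => (hest c hc0 hc1 x x.2 w hw).1, ?_⟩⟩
  have hvol := volume_real_thullenPolydisc hα hc0.le x.2
  have hx2 := norm_snd_lt_one_of_mem x.2
  have hl := one_sub_norm_sq_pos hx2
  have hh : 0 < 1 - thullenRatio α x := sub_pos.mpr ((mem_thullenDomain_iff hα).mp x.2).2
  refine ⟨hvol.1, fun w hw => ?_, ?_, fun w hw => ?_⟩
  · obtain ⟨hwU, hA, hX, ht, -⟩ := hest c hc0 hc1 x x.2 w hw
    have h := hdist (D * c) (by positivity) (hc.trans_le (min_le_left _ _)) x x.2 w hwU hA hX ht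
    have hcomm : skwarczynskiDist (thullenDomain α) x w = skwarczynskiDist (thullenDomain α) w x :=
      (skwarczynskiMetric (isOpen_thullenDomain hα).measurableSet (isBounded_thullenDomain hα)
        hK).dist_comm x ⟨w, hwU⟩
    rwa [hcomm]
  · rw [hvol.2]
    positivity
  · obtain ⟨hwU, -, -, ht, hlw⟩ := hest c hc0 hc1 x x.2 w hw
    have hw2 := norm_snd_lt_one_of_mem hwU
    have hwt := ((mem_thullenDomain_iff hα).mp hwU).2
    have hlw0 := one_sub_norm_sq_pos hw2
    have hw0 := thullenRatio_nonneg (α := α) hw2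
    rw [hvol.2, thullenKernel_self_re hw2]
    have h1 : (2 * (1 - ‖(x : ℂ × ℂ).2‖ ^ 2)) ^ (-(2 + α)) ≤ (1 - ‖w.2‖ ^ 2) ^ (-(2 + α)) :=
      Real.rpow_le_rpow_of_nonpos hlw0 hlw (by linarith)
    have h2 : 1 - thullenRatio α w ≤ 2 * (1 - thullenRatio α x) := by
      have := (abs_le.mp ht).1
      nlinarith
    have h3 : min α 1 / (Real.pi ^ 2 * (2 * (1 - thullenRatio α x)) ^ 3) ≤
        axisKernelReal α (thullenRatio α w) := by
      have h4 := min_le_axis_numerator hα hw0 hwt.le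
      have h5 : 0 < 1 - thullenRatio α w := by linarith
      have := Real.pi_pos
      rw [axisKernelReal]
      gcongr
      linarith
    have e : (1 - ‖(x : ℂ × ℂ).2‖ ^ 2) ^ (2 + α) * (1 - ‖(x : ℂ × ℂ).2‖ ^ 2) ^ (-(2 + α)) = 1 := by
      rw [← Real.rpow_add hl]
      simp
    rw [Real.mul_rpow zero_le_two hl.le] at h1
    calc c ^ 4 * 2 ^ (-(2 + α)) * (min α 1 / 8)
        = Real.pi ^ 2 * c ^ 4 * (1 - thullenRatio α x) ^ 3 * (1 - ‖(x : ℂ × ℂ).2‖ ^ 2) ^ (2 + α) *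
          (2 ^ (-(2 + α)) * (1 - ‖(x : ℂ × ℂ).2‖ ^ 2) ^ (-(2 + α)) *
            (min α 1 / (Real.pi ^ 2 * (2 * (1 - thullenRatio α x)) ^ 3))) := by
          have := Real.pi_ne_zero
          field_simp
          linear_combination (-8 : ℝ) * e
      _ ≤ _ := by gcongr

theorem proposition4p1 (α : ℝ) (hα : 0 < α) (hα1 : α ≠ 1) :
    ∃ m : MetricSpace (thullenDomain α),
      (∀ z w : thullenDomain α,
        m.dist z w = skwarczynskiDist (thullenDomain α) (z : ℂ × ℂ) (w : ℂ × ℂ)) ∧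
      ∃ r₀ : ℝ, r₀ < 1 ∧ ∀ r : ℝ, r₀ < r → r < 1 →
        @HasBoundedOverlapCovering (thullenDomain α) m r := by
  have hm := (isOpen_thullenDomain hα).measurableSet
  have hb := isBounded_thullenDomain hα
  have hK := isBergmanKernel_thullenKernel hα
  -- The threshold 0 suffices, as the packing bound holds at every radius below 1.
  exact ⟨skwarczynskiMetric hm hb hK, skwarczynskiMetric_dist hm hb hK, 0, one_pos,
    fun r hr0 hr1 => hasBoundedOverlapCovering_skwarczynskiMetric hm hb hK
      (exists_thullen_packing_sets hα) hr0.le hr1⟩
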